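/- **Theorem (existence and uniqueness for routed and non-routed classes and multiple destinations).** Let $(\mathcal V,\mathcal A)$, $\mathcal A\subseteq\mathcal V\times\mathcal V$, be a finite, connected directed graph without directed cycles, let $\mathcal A_{\rm in}(v)$ and $\mathcal A_{\rm out}(v)$ be the sets of links that end, respectively originate, in the node $v$, let $\mathcal D\subseteq\mathcal V$ be a set of destinations, and let $K=\{{\rm r},{\rm nr}\}\times\mathcal D$ be the set of commodities. Let $T>0$, $p\in[1,\infty)$, $b,d\in[0,1]$, and for all $a\in\mathcal A$, $k\in K$ let the following be given: * $\lambda_a\in C^1([0,T]\times\mathbb R;\mathbb R_{>0})$; * initial data $\rho^k_{a,0}\in L^\infty((0,1);\mathbb R_{\ge0})$; * sources $s_a^{v,k}\in L^\infty((0,T);\mathbb R_{\ge 0})$, where $v$ is the node in which $a$ originates; * splits $\theta_a^{v,k}\in L^\infty((0,T);\mathbb R_{\ge0})$, $a\in\mathcal A_{\rm out}(v)$, such that $\theta_a^{v,k}=0$ a.e. if the destination of $k$ cannot be reached through $a$ (there is no directed path, possibly of length zero, from the end node of $a$ to it), and $\sum_{a\in\mathcal A_{\rm out}(v)}\theta_a^{v,k}(t)=1$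 for a.e. $t$ at every node $v$ at which the destination of $k$ can be reached through at least one link in $\mathcal A_{\rm out}(v)$. Consider the system, for all $a\in\mathcal A$ and $k\in K$, with $\rho_a:=\sum_{k\in K}\rho_a^k$ and $c_a(t):=\lambda_a\big(t,\int_b^d\rho_a(t,x)\,dx\big)$, $$\partial_t\rho_a^k+\partial_x\big(c_a\rho_a^k\big)=0\ \text{ on }(0,T)\times(0,1),\qquad \rho_a^k(0,\cdot)=\rho_{a,0}^k,\qquad c_a\rho_a^k(\cdot,0)=u_a^k,\qquad c_a\rho_a^k(\cdot,1)=y_a^k,$$ $$u_a^k(t)=s_a^{v,k}(t)+\theta_a^{v,k}(t)\sum_{\tilde a\in\mathcal A_{\rm in}(v)}y_{\tilde a}^k(t)\qquad\text{for a.e. }t\in(0,T),\ v\in\mathcal V,\ a\in\mathcal A_{\rm out}(v),\ k\in K.$$ A weak solution consists of $\rho_a^k\in C([0,T];L^p((0,1)))$ and $u_a^k,y_a^k\in L^1((0,T))$ that satisfy the node conditions and, for every $\varphi\in C^1(\mathbb R^2)$ with $\varphi(T,x)=0$ for $x\in[0,1]$, $$\int_0^T\!\!\int_0^1\rho_a^k\,(\partial_t\varphi+c_a\,\partial_x\varphi)\,dx\,dt+\int_0^1\rho_{a,0}^k(x)\varphi(0,x)\,dx+\int_0^Tu_a^k(t)\varphi(t,0)\,dt-\int_0^Ty_a^k(t)\varphi(t,1)\,dt=0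 .$$ Then there is exactly one weak solution (with $u_a^k,y_a^k$ identified up to null sets), all $\rho_a^k$, $u_a^k$, $y_a^k$ are non-negative (almost everywhere), and $$\rho_a^k\in C([0,T];L^p((0,1)))\cap L^\infty((0,T);L^\infty((0,1)))\qquad\forall a\in\mathcal A,\ k\in K.$$ -/

import Mathlib

open MeasureTheory Set
open scoped ENNReal

/-- A (finite) network: a directed graph with node set `V` and arcs in `V × V` which is connected
(as an undirected graph). -/
structure TrafficNetwork (V : Type*) [Fintype V] [DecidableEq V] where
  arcs : Finset (V × V)
  connected : (SimpleGraph.fromRel fun v w => (v, w) ∈ arcs).Connected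

namespace TrafficNetwork

variable {V : Type*} [Fintype V] [DecidableEq V]

/-- The links of the network. -/
abbrev Link (N : TrafficNetwork V) : Type _ := {a : V × V // a ∈ N.arcs}

/-- The node in which a link originates. -/
def origin {N : TrafficNetwork V} (a : N.Link) : V := a.1.1

/-- The node in which a link ends. -/
def terminus {N : TrafficNetwork V} (a : N.Link) : V := a.1.2

/-- The links which end in `v`. -/
def linksIn (N : TrafficNetwork V) (v : V) : Finset N.Link :=
  Finset.univ.filter fun a => terminus a = v

/-- The links which originate in `v`. -/
def linksOut (N : TrafficNetwork V) (v : V) : Finset N.Link :=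
  Finset.univ.filter fun a => origin a = v

/-- There is no directed cycle: no node can be reached from itself along one or more links. -/
def Acyclic (N : TrafficNetwork V) : Prop :=
  ∀ v : V, ¬ Relation.TransGen (fun v w => (v, w) ∈ N.arcs) v v

/-- The node `z` can be reached through the link `a`: there is a directed path (possibly of
length zero) from the end node of `a` to `z`. -/
def ReachableThrough {N : TrafficNetwork V} (a : N.Link) (z : V) : Prop :=
  Relation.ReflTransGen (fun v w => (v, w) ∈ N.arcs) (terminus a) z

end TrafficNetwork

/-- The two classes of drivers. -/
inductive DriverClass where
  | routed : DriverClass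
  | nonRouted : DriverClass
  deriving DecidableEq

instance : Fintype DriverClass where
  elems := {DriverClass.routed, DriverClass.nonRouted}
  complete := by intro c; cases c <;> simp

/-- The commodities: pairs of a class of drivers and a destination. -/
abbrev Commodity {V : Type*} (D : Finset V) : Type _ := DriverClass × {v : V // v ∈ D}

/-- `f ∈ L^∞(I; ℝ_{≥0})`. -/
def IsNonnegLinfty (I : Set ℝ) (f : ℝ → ℝ) : Prop :=
  MemLp f ∞ (volume.restrict I) ∧ ∀ᵐ t ∂volume.restrict I, 0 ≤ f t

/-- The real Lebesgue space `L^p((0,1))`. -/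
noncomputable abbrev LpUnit (p : ℝ≥0∞) := Lp ℝ p (volume.restrict (Ioo (0 : ℝ) 1))

namespace TrafficNetwork

variable {V : Type*} [Fintype V] [DecidableEq V]

/-- The set of splits. Since `a` determines the node `v` in which it originates, the split
`θ_a^{v,k}` is written `θ a k`. A commodity is never sent into a link through which its destination
cannot be reached, and at a node from which its destination can be reached through at least one
outgoing link the splits over the outgoing links add up to one. -/
structure IsSplit (N : TrafficNetwork V) (D : Finset V) (T : ℝ)
    (θ : N.Link → Commodity D → ℝ → ℝ) : Prop where
  nonneg_linfty : ∀ a k, IsNonnegLinfty (Ioo 0 T) (θ a k)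
  eq_zero : ∀ a (k : Commodity D), ¬ ReachableThrough a (k.2 : V) →
    ∀ᵐ t ∂volume.restrict (Ioo 0 T), θ a k t = 0
  sum_eq_one : ∀ (v : V) (k : Commodity D),
    (∃ a ∈ N.linksOut v, ReachableThrough a (k.2 : V)) →
    ∀ᵐ t ∂volume.restrict (Ioo 0 T), ∑ a ∈ N.linksOut v, θ a k t = 1

end TrafficNetwork

/-- The velocity `λ(t, ∫_b^d ∑_k ρ^k(t,y) dy)` on a link at time `t`, common to all commodities. -/
noncomputable def linkVelocity {K : Type*} [Fintype K] {p : ℝ≥0∞} (lam : ℝ → ℝ → ℝ) (b d : ℝ)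
    (ρ : K → ℝ → LpUnit p) (t : ℝ) : ℝ :=
  lam t (∫ x in b..d, ∑ k, ρ k t x)

/-- `r` is a weak solution of `∂_t r + ∂_x (c(t) r) = 0` on `(0,T) × (0,1)` with
`r(0,x) = r0(x)`, `c(t) r(t,0) = u(t)` and `c(t) r(t,1) = y(t)`: the equation is multiplied by a
test function which vanishes at `t = T`, and integrated by parts. As the test function is arbitrary
at `t = 0`, `x = 0` and `x = 1`, the identity contains the initial condition and says that `u`
and `y` are the traces of the flux at the two ends. -/
def IsWeakTransportSolution {p : ℝ≥0∞} (T : ℝ) (c : ℝ → ℝ) (r0 u y : ℝ → ℝ)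
    (r : ℝ → LpUnit p) : Prop :=
  ∀ φ : ℝ × ℝ → ℝ, ContDiff ℝ 1 φ → (∀ x ∈ Icc (0 : ℝ) 1, φ (T, x) = 0) →
    (∫ t in (0 : ℝ)..T, ∫ x in (0 : ℝ)..1,
        r t x * (fderiv ℝ φ (t, x) (1, 0) + c t * fderiv ℝ φ (t, x) (0, 1)))
      + (∫ x in (0 : ℝ)..1, r0 x * φ (0, x))
      + (∫ t in (0 : ℝ)..T, u t * φ (t, 0))
      - (∫ t in (0 : ℝ)..T, y t * φ (t, 1)) = 0

namespace TrafficNetwork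

variable {V : Type*} [Fintype V] [DecidableEq V]

/-- `(ρ, u, y)` (densities, inflows and outflows of all commodities on all links) is a weak solution
of the multi-commodity non-local model on the network, with `ρ_a^k ∈ C([0,T]; L^p((0,1)))`. -/
structure IsWeakSolution {p : ℝ≥0∞} [Fact (1 ≤ p)] (N : TrafficNetwork V) (D : Finset V)
    (T : ℝ) (lam : N.Link → ℝ → ℝ → ℝ) (b d : ℝ)
    (ρ0 θ s : N.Link → Commodity D → ℝ → ℝ)
    (ρ : N.Link → Commodity D → ℝ → LpUnit p) (u y : N.Link → Commodity D → ℝ → ℝ) : Prop where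
  continuousOn : ∀ a k, ContinuousOn (ρ a k) (Icc 0 T)
  integrable_inflow : ∀ a k, IntegrableOn (u a k) (Ioo 0 T)
  integrable_outflow : ∀ a k, IntegrableOn (y a k) (Ioo 0 T)
  weak : ∀ a k,
    IsWeakTransportSolution T (linkVelocity (lam a) b d (ρ a)) (ρ0 a k) (u a k) (y a k) (ρ a k)
  node : ∀ a k, ∀ᵐ t ∂volume.restrict (Ioo 0 T),
    u a k t = s a k t + θ a k t * ∑ a' ∈ N.linksIn (origin a), y a' k t

end TrafficNetwork

/-! On one link with a prescribed velocity c, the equation is solved along characteristics. With the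
displacement C(t), the integral of c over [0,t], the density is g(C(t) - x); the profile g is read
off from the inflow, and the initial density counts as inflow before time 0. `weakDefect_eq_zero`
shows that this is a weak solution, by approximating g in L¹ with smooth functions.
`IsWeakTransportSolution.unique` shows that it is the only one, by testing with functions whose
derivative along characteristics is prescribed.

The non-local coupling then becomes an equation for the single function c. All commodities on a link
share c, so the mass between b and d is an increment of the total cumulative inflow U between the
entrance times C⁻¹(C(t) - d) and C⁻¹(C(t) - b). Since U is Lipschitz, the map from c to the velocity
caused by its load satisfies a Volterra estimate; an iterate is a contraction, and
`exists_unique_velocity` gives exactly one fixed point. The velocity law need not be globally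
Lipschitz in the load, but the load never exceeds the total mass fed in, so the law may be truncated
beyond that value.

Conversely, the velocity of any weak solution is continuous and positive on [0,T]. Taken as given,
it forces the explicit density by linear uniqueness, and hence solves the same fixed point equation
(`exists_velocity_of_weak`). Together this yields `exists_unique_link`.

Without directed cycles the links are well-founded under "ends where the other begins". The inflow
of a link depends only on outflows of its predecessors, which are again bounded and non-negative, so
solutions are built by recursion on the links, and uniqueness follows by the same induction. -/

/-! ### Displacement, its inverse, and change of variables. -/

/-- A continuous velocity which is bounded from above and away from zero. -/
structure IsVelocity (m M : ℝ) (c : ℝ → ℝ) : Prop where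
  pos : 0 < m
  continuous : Continuous c
  lower : ∀ t, m ≤ c t
  upper : ∀ t, c t ≤ M

/-- The distance covered between time `0` and time `t` at velocity `c`. -/
noncomputable def displacement (c : ℝ → ℝ) (t : ℝ) : ℝ := ∫ s in (0 : ℝ)..t, c s

/-- The time at which the displacement attains a given value. -/
noncomputable def passage (c : ℝ → ℝ) : ℝ → ℝ := Function.invFun (displacement c)

/-- The density, in the coordinate moving with the velocity `c`, created by the inflow `w`. -/
noncomputable def profile (c w : ℝ → ℝ) (z : ℝ) : ℝ := w (passage c z) / c (passage c z)

@[simp] lemma displacement_zero (c : ℝ → ℝ) : displacement c 0 = 0 := by simp [displacement]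

namespace IsVelocity

variable {m M : ℝ} {c : ℝ → ℝ}

lemma velocity_pos (h : IsVelocity m M c) (t : ℝ) : 0 < c t := h.pos.trans_le (h.lower t)

lemma abs_le (h : IsVelocity m M c) (t : ℝ) : |c t| ≤ M := by
  rw [abs_of_pos (h.velocity_pos t)]; exact h.upper t

lemma hasDerivAt_displacement (h : IsVelocity m M c) (t : ℝ) :
    HasDerivAt (displacement c) (c t) t :=
  intervalIntegral.integral_hasDerivAt_right (h.continuous.intervalIntegrable _ _)
    (h.continuous.stronglyMeasurableAtFilter _ _) h.continuous.continuousAt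

lemma deriv_displacement (h : IsVelocity m M c) : deriv (displacement c) = c :=
  funext fun t => (h.hasDerivAt_displacement t).deriv

lemma contDiff_displacement (h : IsVelocity m M c) : ContDiff ℝ 1 (displacement c) := by
  rw [contDiff_one_iff_deriv]
  refine ⟨fun t => (h.hasDerivAt_displacement t).differentiableAt, ?_⟩
  rw [h.deriv_displacement]; exact h.continuous

lemma continuous_displacement (h : IsVelocity m M c) : Continuous (displacement c) :=
  h.contDiff_displacement.continuous

lemma displacement_sub (h : IsVelocity m M c) (s t : ℝ) :
    displacement c t - displacement c s = ∫ r in s..t, c r :=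
  intervalIntegral.integral_interval_sub_left (h.continuous.intervalIntegrable _ _)
    (h.continuous.intervalIntegrable _ _)

lemma mul_sub_le (h : IsVelocity m M c) {s t : ℝ} (hst : s ≤ t) :
    m * (t - s) ≤ displacement c t - displacement c s := by
  rw [h.displacement_sub]
  have := intervalIntegral.integral_mono_on (f := fun _ => m) (g := c) (μ := volume) hst
    (by simp) (h.continuous.intervalIntegrable _ _) (fun x _ => h.lower x)
  simpa [mul_comm] using this

lemma strictMono_displacement (h : IsVelocity m M c) : StrictMono (displacement c) :=
  fun s t hst => by
  have := h.mul_sub_le hst.le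
  have := mul_pos h.pos (sub_pos.2 hst)
  linarith

lemma mul_abs_sub_le (h : IsVelocity m M c) (s t : ℝ) :
    m * |t - s| ≤ |displacement c t - displacement c s| := by
  rcases le_total s t with hst | hst
  · rw [abs_of_nonneg (sub_nonneg.2 hst),
      abs_of_nonneg (sub_nonneg.2 (h.strictMono_displacement.monotone hst))]
    exact h.mul_sub_le hst
  · rw [abs_sub_comm t, abs_sub_comm (displacement c t), abs_of_nonneg (sub_nonneg.2 hst),
      abs_of_nonneg (sub_nonneg.2 (h.strictMono_displacement.monotone hst))]
    exact h.mul_sub_le hst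

lemma surjective_displacement (h : IsVelocity m M c) : Function.Surjective (displacement c) := by
  refine h.continuous_displacement.surjective ?_ ?_
  · refine Filter.tendsto_atTop_mono' _ ?_ (Filter.tendsto_id.const_mul_atTop h.pos)
    filter_upwards [Filter.eventually_ge_atTop 0] with t ht
    simpa using h.mul_sub_le ht
  · refine Filter.tendsto_atBot_mono' _ ?_ (Filter.tendsto_id.const_mul_atBot h.pos)
    filter_upwards [Filter.eventually_le_atBot 0] with t ht
    have := h.mul_sub_le ht
    simp only [displacement_zero, id] at *
    linarith

@[simp] lemma displacement_passage (h : IsVelocity m M c) (z : ℝ) :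
    displacement c (passage c z) = z :=
  Function.rightInverse_invFun h.surjective_displacement z

@[simp] lemma passage_displacement (h : IsVelocity m M c) (t : ℝ) :
    passage c (displacement c t) = t :=
  Function.leftInverse_invFun h.strictMono_displacement.injective t

/-- The lower bound `m` on the speed makes the displacement expanding, hence its inverse Lipschitz.
-/
lemma mul_abs_passage_sub_le (h : IsVelocity m M c) (z w : ℝ) :
    m * |passage c z - passage c w| ≤ |z - w| := by
  simpa only [h.displacement_passage] using h.mul_abs_sub_le (passage c w) (passage c z)

lemma continuous_passage (h : IsVelocity m M c) : Continuous (passage c) := by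
  refine LipschitzWith.continuous (K := Real.toNNReal m⁻¹)
    (LipschitzWith.of_dist_le_mul fun z w => ?_)
  rw [Real.dist_eq, Real.dist_eq, Real.coe_toNNReal _ (inv_nonneg.2 h.pos.le), inv_mul_eq_div,
    le_div_iff₀' h.pos]
  exact h.mul_abs_passage_sub_le z w

lemma passage_le_iff (h : IsVelocity m M c) {z t : ℝ} : passage c z ≤ t ↔ z ≤ displacement c t := by
  rw [← h.strictMono_displacement.le_iff_le, h.displacement_passage]

lemma image_displacement_Ioc (h : IsVelocity m M c) (a b : ℝ) :
    displacement c '' Ioc a b = Ioc (displacement c a) (displacement c b) := by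
  ext z
  constructor
  · rintro ⟨t, ht, rfl⟩
    exact ⟨h.strictMono_displacement ht.1, h.strictMono_displacement.monotone ht.2⟩
  · rintro hz
    refine ⟨passage c z, ⟨?_, h.passage_le_iff.2 hz.2⟩, h.displacement_passage z⟩
    rw [← not_le, h.passage_le_iff, not_le]; exact hz.1

/-- The substitution rule for monotone maps needs neither measurability nor integrability of `g`. -/
lemma setIntegral_displacement (h : IsVelocity m M c) (a b : ℝ) (g : ℝ → ℝ) :
    ∫ z in Ioc (displacement c a) (displacement c b), g z =
      ∫ t in Ioc a b, c t * g (displacement c t) := by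
  rw [← h.image_displacement_Ioc]
  simpa using integral_image_eq_integral_deriv_smul_of_monotoneOn
    (measurableSet_Ioc (a := a) (b := b))
    (fun t _ => (h.hasDerivAt_displacement t).hasDerivWithinAt)
    (h.strictMono_displacement.monotone.monotoneOn _) g

/-- Change of variables between time and displacement. -/
lemma integral_displacement (h : IsVelocity m M c) (a b : ℝ) (g : ℝ → ℝ) :
    ∫ z in displacement c a..displacement c b, g z =
      ∫ t in a..b, c t * g (displacement c t) := by
  simp only [intervalIntegral, h.setIntegral_displacement]

lemma mul_profile (h : IsVelocity m M c) (w : ℝ → ℝ) (t : ℝ) :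
    c t * profile c w (displacement c t) = w t := by
  rw [profile, h.passage_displacement, mul_div_cancel₀ _ (h.velocity_pos t).ne']

/-- Conservation of mass: what lies between two moving coordinates is what entered between their
passage times. -/
lemma integral_profile (h : IsVelocity m M c) (w : ℝ → ℝ) (z₁ z₂ : ℝ) :
    ∫ z in z₁..z₂, profile c w z = ∫ t in passage c z₁..passage c z₂, w t := by
  have := h.integral_displacement (passage c z₁) (passage c z₂) (profile c w)
  simpa only [h.displacement_passage, h.mul_profile] using this

lemma measurable_profile (h : IsVelocity m M c) {w : ℝ → ℝ} (hw : Measurable w) :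
    Measurable (profile c w) :=
  (hw.comp h.continuous_passage.measurable).div
    (h.continuous.measurable.comp h.continuous_passage.measurable)

lemma profile_nonneg (h : IsVelocity m M c) {w : ℝ → ℝ} (hw : ∀ t, 0 ≤ w t) (z : ℝ) :
    0 ≤ profile c w z := div_nonneg (hw _) (h.velocity_pos _).le

lemma abs_profile_le (h : IsVelocity m M c) {w : ℝ → ℝ} {B : ℝ} (hw : ∀ t, |w t| ≤ B) (z : ℝ) :
    |profile c w z| ≤ B / m := by
  rw [profile, abs_div]
  have := (abs_nonneg _).trans (hw 0)
  exact div_le_div₀ this (hw _) h.pos ((h.lower _).trans (le_abs_self _))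

lemma displacement_of_nonpos {c₀ : ℝ} (hc : ∀ t ≤ 0, c t = c₀) {t : ℝ}
    (ht : t ≤ 0) : displacement c t = c₀ * t := by
  rw [displacement, intervalIntegral.integral_congr (g := fun _ => c₀)]
  · simp [mul_comm]
  · intro s hs
    rw [uIcc_of_ge ht] at hs
    exact hc s hs.2

/-- Freezing the velocity before time 0 makes the fictitious entrance times of the initial mass
depend on `c₀` only. -/
lemma passage_of_nonpos (h : IsVelocity m M c) {c₀ : ℝ} (hc : ∀ t ≤ 0, c t = c₀) {z : ℝ}
    (hz : z ≤ 0) : passage c z = z / c₀ := by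
  have h0 : 0 < c₀ := hc 0 le_rfl ▸ h.velocity_pos 0
  have : displacement c (z / c₀) = z := by
    rw [displacement_of_nonpos hc (div_nonpos_of_nonpos_of_nonneg hz h0.le)]; field_simp
  conv_lhs => rw [← this]
  exact h.passage_displacement _

end IsVelocity

/-! ### The load and the fixed point equation for the velocity. -/

section

open scoped BoundedContinuousFunction Nat

/-- The mass between the positions `b` and `d` at time `t`, where `U` is the cumulative inflow and
everything moves with velocity `c`. -/
noncomputable def load (c U : ℝ → ℝ) (b d t : ℝ) : ℝ :=
  U (passage c (displacement c t - b)) - U (passage c (displacement c t - d))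

lemma IsVelocity.continuous_load {m M : ℝ} {c U : ℝ → ℝ} (h : IsVelocity m M c) (hU : Continuous U)
    (b d : ℝ) : Continuous (load c U b d) := by
  have h1 := h.continuous_displacement
  have h2 := h.continuous_passage
  unfold load
  fun_prop

/-- The time `s` may be negative, since mass present at time `t` may stem from the initial density;
there the displacements coincide. -/
lemma abs_displacement_sub_le {m M : ℝ} {c₁ c₂ : ℝ → ℝ} (h₁ : IsVelocity m M c₁)
    (h₂ : IsVelocity m M c₂) (h : ∀ t ≤ 0, c₁ t = c₂ t) {s t : ℝ} (hst : s ≤ t) (ht : 0 ≤ t) :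
    |displacement c₁ s - displacement c₂ s| ≤ ∫ r in (0 : ℝ)..t, |c₁ r - c₂ r| := by
  have hc : Continuous fun r => |c₁ r - c₂ r| := (h₁.continuous.sub h₂.continuous).abs
  have h0 : 0 ≤ ∫ r in (0 : ℝ)..t, |c₁ r - c₂ r| :=
    intervalIntegral.integral_nonneg ht fun _ _ => abs_nonneg _
  have e : displacement c₁ s - displacement c₂ s = ∫ r in (0 : ℝ)..s, (c₁ r - c₂ r) :=
    (intervalIntegral.integral_sub (h₁.continuous.intervalIntegrable _ _)
      (h₂.continuous.intervalIntegrable _ _)).symm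
  rcases le_total s 0 with hs | hs
  · rw [e, intervalIntegral.integral_congr (g := fun _ => 0)]
    · simpa using h0
    · intro r hr
      rw [uIcc_of_ge hs] at hr
      simp [h r hr.2]
  · rw [e]
    refine (intervalIntegral.abs_integral_le_integral_abs hs).trans ?_
    rw [← intervalIntegral.integral_add_adjacent_intervals (hc.intervalIntegrable 0 s)
      (hc.intervalIntegrable s t)]
    have := intervalIntegral.integral_nonneg (μ := volume) hst fun r _ => abs_nonneg (c₁ r - c₂ r)
    linarith

/-- Evaluate the first displacement C₁ at both entrance times: C₁(s₁) - C₁(s₂) = (C₁ - C₂)(t) - (C₁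
- C₂)(s₂). Each term on the right is at most the integral, and C₁ expands distances by at least `m`.
-/
lemma abs_passage_sub_le {m M : ℝ} {c₁ c₂ : ℝ → ℝ} (h₁ : IsVelocity m M c₁)
    (h₂ : IsVelocity m M c₂) (h : ∀ t ≤ 0, c₁ t = c₂ t) {t x : ℝ} (ht : 0 ≤ t) (hx : 0 ≤ x) :
    m * |passage c₁ (displacement c₁ t - x) - passage c₂ (displacement c₂ t - x)| ≤
      2 * ∫ r in (0 : ℝ)..t, |c₁ r - c₂ r| := by
  set s₁ := passage c₁ (displacement c₁ t - x)
  set s₂ := passage c₂ (displacement c₂ t - x)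
  have hs₂ : s₂ ≤ t := h₂.passage_le_iff.2 (by linarith)
  have e₁ : displacement c₁ s₁ = displacement c₁ t - x := h₁.displacement_passage _
  have e₂ : displacement c₂ s₂ = displacement c₂ t - x := h₂.displacement_passage _
  have a := abs_displacement_sub_le h₁ h₂ h le_rfl ht
  have b := abs_displacement_sub_le h₁ h₂ h hs₂ ht
  have : displacement c₁ s₁ - displacement c₁ s₂ =
      (displacement c₁ t - displacement c₂ t) - (displacement c₁ s₂ - displacement c₂ s₂) := by
    rw [e₁, e₂]; ring
  have k := h₁.mul_abs_sub_le s₂ s₁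
  rw [this] at k
  have := abs_sub (displacement c₁ t - displacement c₂ t) (displacement c₁ s₂ - displacement c₂ s₂)
  linarith

lemma abs_load_sub_le {m M K : ℝ} {c₁ c₂ U : ℝ → ℝ} (h₁ : IsVelocity m M c₁)
    (h₂ : IsVelocity m M c₂) (h : ∀ t ≤ 0, c₁ t = c₂ t) (hK : 0 ≤ K)
    (hU : ∀ s t, |U s - U t| ≤ K * |s - t|) {b d t : ℝ} (ht : 0 ≤ t) (hb : 0 ≤ b) (hd : 0 ≤ d) :
    |load c₁ U b d t - load c₂ U b d t| ≤ 4 * K / m * ∫ r in (0 : ℝ)..t, |c₁ r - c₂ r| := by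
  have key : ∀ x, 0 ≤ x → |U (passage c₁ (displacement c₁ t - x)) -
      U (passage c₂ (displacement c₂ t - x))| ≤ 2 * K / m * ∫ r in (0 : ℝ)..t, |c₁ r - c₂ r| := by
    intro x hx
    refine (hU _ _).trans ?_
    have := abs_passage_sub_le h₁ h₂ h ht hx
    rw [← le_div_iff₀' h₁.pos] at this
    refine (mul_le_mul_of_nonneg_left this hK).trans (le_of_eq ?_)
    ring
  have h1 := key b hb
  have h2 := key d hd
  have : load c₁ U b d t - load c₂ U b d t = (U (passage c₁ (displacement c₁ t - b)) -
      U (passage c₂ (displacement c₂ t - b))) - (U (passage c₁ (displacement c₁ t - d)) -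
      U (passage c₂ (displacement c₂ t - d))) := by
    simp only [load]; ring
  rw [this]
  refine (abs_sub _ _).trans ((add_le_add h1 h2).trans (le_of_eq ?_))
  ring

lemma integral_pow_div_factorial (n : ℕ) (Q t : ℝ) :
    ∫ s in (0 : ℝ)..t, (Q * s) ^ n / n ! = Q ^ n * t ^ (n + 1) / (n + 1)! := by
  simp only [mul_pow, mul_div_assoc]
  rw [intervalIntegral.integral_const_mul, intervalIntegral.integral_div, integral_pow,
    Nat.factorial_succ]
  push_cast
  have : ((n : ℝ) + 1) ≠ 0 := by positivity
  have : (n ! : ℝ) ≠ 0 := by positivity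
  field_simp
  simp

/-- A self-map which is Lipschitz in the integrated (Volterra) sense has exactly one fixed point. -/
theorem exists_unique_fixedPoint_of_volterra {S : Set (ℝ →ᵇ ℝ)} (hS : IsClosed S) (hne : S.Nonempty)
    (Φ : S → S) {T Q : ℝ} (hT : 0 ≤ T) (hQ : 0 ≤ Q)
    (hΦ : ∀ (c₁ c₂ : S) (t : ℝ), |(Φ c₁).1 t - (Φ c₂).1 t| ≤
      Q * ∫ r in (0 : ℝ)..(max 0 (min t T)), |c₁.1 r - c₂.1 r|) :
    ∃! c : S, Φ c = c := by
  have : CompleteSpace S := hS.completeSpace_coe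
  have : Nonempty S := hne.to_subtype
  -- Each application of the Volterra estimate integrates once more in time and so produces the
  -- factorial.
  have it : ∀ (n : ℕ) (c₁ c₂ : S) (t : ℝ), |(Φ^[n] c₁).1 t - (Φ^[n] c₂).1 t| ≤
      (Q * max 0 (min t T)) ^ n / n ! * dist c₁ c₂ := by
    intro n c₁ c₂
    induction n with
    | zero => intro t; simpa [Real.dist_eq, Subtype.dist_eq] using
      BoundedContinuousFunction.dist_coe_le_dist (f := c₁.1) (g := c₂.1) t
    | succ n ih =>
      intro t
      rw [Function.iterate_succ_apply', Function.iterate_succ_apply']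
      refine (hΦ _ _ t).trans ?_
      set p := max 0 (min t T) with hp
      have hp0 : 0 ≤ p := le_max_left _ _
      have hpT : p ≤ T := max_le hT (min_le_right _ _)
      have : ∫ r in (0 : ℝ)..p, |(Φ^[n] c₁).1 r - (Φ^[n] c₂).1 r| ≤
          ∫ r in (0 : ℝ)..p, (Q * r) ^ n / n ! * dist c₁ c₂ := by
        refine intervalIntegral.integral_mono_on hp0
          (Continuous.intervalIntegrable (by fun_prop) _ _)
          (Continuous.intervalIntegrable (by fun_prop) _ _) fun r hr => ?_
        have := ih r
        rwa [min_eq_left (hr.2.trans hpT), max_eq_right hr.1] at this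
      rw [intervalIntegral.integral_mul_const, integral_pow_div_factorial] at this
      refine (mul_le_mul_of_nonneg_left this hQ).trans (le_of_eq ?_)
      rw [mul_pow]; ring
  obtain ⟨n, hn⟩ := ((FloorSemiring.tendsto_pow_div_factorial_atTop (Q * T)).eventually
    (gt_mem_nhds zero_lt_one)).exists
  have h0 : 0 ≤ (Q * T) ^ n / n ! := by positivity
  have hc : ContractingWith ⟨_, h0⟩ Φ^[n] := by
    refine ⟨hn, LipschitzWith.of_dist_le_mul fun c₁ c₂ => ?_⟩
    change dist (Φ^[n] c₁).1 (Φ^[n] c₂).1 ≤ (Q * T) ^ n / n ! * _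
    refine (BoundedContinuousFunction.dist_le (by positivity)).2 fun t => ?_
    rw [Real.dist_eq]
    refine (it n c₁ c₂ t).trans ?_
    gcongr
    exact max_le hT (min_le_right _ _)
  -- The fixed point of a contracting iterate is fixed by the map itself, and every fixed point of
  -- the map is one of the iterate.
  refine ⟨_, hc.isFixedPt_fixedPoint_iterate, fun c hcf => ?_⟩
  exact hc.fixedPoint_unique (Function.IsFixedPt.iterate hcf n)

/-- A velocity depending on the load which it causes exists and is unique. -/
theorem exists_unique_velocity {lam : ℝ → ℝ → ℝ} (hlam : Continuous (Function.uncurry lam))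
    {m M L K T b d c₀ : ℝ} {U : ℝ → ℝ} (hm : 0 < m) (hml : ∀ t w, m ≤ lam t w)
    (hlM : ∀ t w, lam t w ≤ M) (hL : 0 ≤ L)
    (hlip : ∀ t w w', |lam t w - lam t w'| ≤ L * |w - w'|) (hK : 0 ≤ K)
    (hU : ∀ s t, |U s - U t| ≤ K * |s - t|) (hT : 0 ≤ T) (hb : 0 ≤ b) (hd : 0 ≤ d)
    (hc₀ : lam 0 (U (-b / c₀) - U (-d / c₀)) = c₀) :
    ∃! c : ℝ → ℝ, IsVelocity m M c ∧ (∀ t ≤ 0, c t = c₀) ∧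
      ∀ t, c t = lam (max 0 (min t T)) (load c U b d (max 0 (min t T))) := by
  have hUc : Continuous U := by
    refine LipschitzWith.continuous (K := ⟨K, hK⟩) (LipschitzWith.of_dist_le_mul fun s t => ?_)
    exact hU s t
  let S : Set (ℝ →ᵇ ℝ) := {c | (∀ t, m ≤ c t) ∧ (∀ t, c t ≤ M) ∧ ∀ t ≤ 0, c t = c₀}
  have hS : IsClosed S := by
    have ev : ∀ t : ℝ, Continuous fun c : ℝ →ᵇ ℝ => c t := fun t =>
      continuous_eval_const t
    simp only [S, ofPred_and, ofPred_forall]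
    refine (isClosed_iInter fun t => isClosed_le continuous_const (ev t)).inter
      ((isClosed_iInter fun t => isClosed_le (ev t) continuous_const).inter
      (isClosed_iInter fun t => isClosed_iInter fun _ => isClosed_eq (ev t) continuous_const))
  have vel : ∀ c : ℝ →ᵇ ℝ, c ∈ S → IsVelocity m M c := fun c hc =>
    ⟨hm, c.continuous, hc.1, hc.2.1⟩
  have hne : S.Nonempty := by
    refine ⟨BoundedContinuousFunction.const ℝ c₀, fun t => ?_, fun t => ?_, fun t _ => rfl⟩
    · simpa using hc₀ ▸ hml 0 (U (-b / c₀) - U (-d / c₀))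
    · simpa using hc₀ ▸ hlM 0 (U (-b / c₀) - U (-d / c₀))
  have cont : ∀ c : ℝ → ℝ, IsVelocity m M c →
      Continuous fun t => lam (max 0 (min t T)) (load c U b d (max 0 (min t T))) := fun c hc => by
    have h1 := hc.continuous_load hUc b d
    have h2 : Continuous fun t : ℝ => (max 0 (min t T), load c U b d (max 0 (min t T))) := by
      fun_prop
    exact hlam.comp h2
  have bd : ∀ t w, |lam t w| ≤ M := fun t w => by
    rw [abs_of_pos (hm.trans_le (hml t w))]; exact hlM t w
  -- For nonpositive times the clamped time is 0, where the entrance times are `-b / c₀` and `-d /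
  -- c₀` whatever `c` is; `hc₀` then says that the image again takes the value `c₀`.
  let Φ : S → S := fun c => ⟨BoundedContinuousFunction.ofNormedAddCommGroup _
    (cont c.1 (vel _ c.2)) M
    (fun t => bd _ _), fun t => hml _ _, fun t => hlM _ _, fun t ht => by
      have hv := vel _ c.2
      simp only [BoundedContinuousFunction.coe_ofNormedAddCommGroup]
      rw [max_eq_left ((min_le_left _ _).trans ht), load, displacement_zero,
        hv.passage_of_nonpos c.2.2.2 (by linarith), hv.passage_of_nonpos c.2.2.2 (by linarith)]
      simpa using hc₀⟩
  have Φ_apply : ∀ (c : S) t, (Φ c).1 t =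
    lam (max 0 (min t T)) (load c.1 U b d (max 0 (min t T))) := fun c t => rfl
  obtain ⟨c, hc, huniq⟩ := exists_unique_fixedPoint_of_volterra hS hne Φ (Q := L * (4 * K / m)) hT
    (by positivity) fun c₁ c₂ t => by
      rw [Φ_apply, Φ_apply, mul_assoc]
      refine (hlip _ _ _).trans (mul_le_mul_of_nonneg_left ?_ hL)
      exact abs_load_sub_le (vel _ c₁.2) (vel _ c₂.2)
        (fun t ht => (c₁.2.2.2 t ht).trans (c₂.2.2.2 t ht).symm) hK hU (le_max_left _ _) hb hd
  refine ⟨c.1, ⟨vel _ c.2, c.2.2.2, fun t => ?_⟩, fun c' ⟨hv, h0, he⟩ => ?_⟩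
  · rw [← Φ_apply, hc]
  · let C : ℝ →ᵇ ℝ := BoundedContinuousFunction.ofNormedAddCommGroup c' hv.continuous M
      fun t => hv.abs_le t
    have hC : C ∈ S := ⟨hv.lower, hv.upper, h0⟩
    have := huniq ⟨C, hC⟩ (Subtype.ext (BoundedContinuousFunction.ext fun t => (he t).symm))
    rw [← this]; rfl

end

/-! ### Densities moving along characteristics satisfy the weak formulation. -/

lemma intervalIntegrable_of_measurable_of_bdd {f : ℝ → ℝ} {a b B : ℝ} (hf : Measurable f)
    (hB : ∀ t ∈ uIcc a b, |f t| ≤ B) : IntervalIntegrable f volume a b := by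
  rw [intervalIntegrable_iff']
  exact Measure.integrableOn_of_bounded (M := B) (by simp) hf.aestronglyMeasurable
    ((ae_restrict_iff' measurableSet_uIcc).2 (.of_forall hB))

/-- The derivative of `φ` along the curves of velocity `c`. -/
noncomputable def materialDeriv (c : ℝ → ℝ) (φ : ℝ × ℝ → ℝ) (t x : ℝ) : ℝ :=
  fderiv ℝ φ (t, x) (1, 0) + c t * fderiv ℝ φ (t, x) (0, 1)

lemma continuous_materialDeriv {c : ℝ → ℝ} {φ : ℝ × ℝ → ℝ} (hc : Continuous c)
    (hφ : ContDiff ℝ 1 φ) : Continuous fun q : ℝ × ℝ => materialDeriv c φ q.1 q.2 := by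
  have h : Continuous (fderiv ℝ φ) := hφ.continuous_fderiv one_ne_zero
  unfold materialDeriv
  fun_prop

/-- The left-hand side of the weak formulation for the density `g (C(t) - x)`, where `C` is the
displacement. -/
noncomputable def weakDefect (T : ℝ) (c : ℝ → ℝ) (φ : ℝ × ℝ → ℝ) (g : ℝ → ℝ) : ℝ :=
  (∫ t in (0 : ℝ)..T, ∫ x in (0 : ℝ)..1, g (displacement c t - x) * materialDeriv c φ t x)
    + (∫ x in (0 : ℝ)..1, g (-x) * φ (0, x))
    + (∫ t in (0 : ℝ)..T, c t * g (displacement c t) * φ (t, 0))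
    - (∫ t in (0 : ℝ)..T, c t * g (displacement c t - 1) * φ (t, 1))

section

variable {m M T : ℝ} {c : ℝ → ℝ} {φ : ℝ × ℝ → ℝ}

/-- For smooth `g` the function g(C(t) - x) is constant along characteristics, so g times the
material derivative of `φ` is the material derivative of the product. Integrating its two parts in x
and in t leaves exactly the boundary terms. -/
lemma weakDefect_eq_zero_of_contDiff (hc : IsVelocity m M c) (hφ : ContDiff ℝ 1 φ)
    (hφT : ∀ x ∈ Icc (0 : ℝ) 1, φ (T, x) = 0) {g : ℝ → ℝ} (hg : ContDiff ℝ 1 g) :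
    weakDefect T c φ g = 0 := by
  have hC := hc.continuous_displacement
  have hg' : Continuous (deriv g) := hg.continuous_deriv le_rfl
  have hf' : Continuous (fderiv ℝ φ) := hφ.continuous_fderiv one_ne_zero
  have hcc := hc.continuous
  have hgc := hg.continuous
  have hφc := hφ.continuous
  have dg : ∀ z, HasDerivAt g (deriv g z) z := fun z =>
    (hg.differentiable one_ne_zero z).hasDerivAt
  have dφ : ∀ q, HasFDerivAt φ (fderiv ℝ φ q) q := fun q =>
    (hφ.differentiable one_ne_zero q).hasFDerivAt
  let ft : ℝ → ℝ → ℝ := fun t x => c t * deriv g (displacement c t - x) * φ (t, x) +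
    g (displacement c t - x) * fderiv ℝ φ (t, x) (1, 0)
  let fx : ℝ → ℝ → ℝ := fun t x => -deriv g (displacement c t - x) * φ (t, x) +
    g (displacement c t - x) * fderiv ℝ φ (t, x) (0, 1)
  have dt : ∀ t x, HasDerivAt (fun t => g (displacement c t - x) * φ (t, x)) (ft t x) t := by
    intro t x
    have h1 : HasDerivAt (fun t => g (displacement c t - x))
        (deriv g (displacement c t - x) * c t) t :=
      (dg _).comp t ((hc.hasDerivAt_displacement t).sub_const x)
    have h2 : HasDerivAt (fun t => φ (t, x)) (fderiv ℝ φ (t, x) (1, 0)) t :=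
      (dφ (t, x)).comp_hasDerivAt t ((hasDerivAt_id t).prodMk (hasDerivAt_const t x))
    refine (h1.mul h2).congr_deriv ?_
    simp only [ft]; ring
  have dx : ∀ t x, HasDerivAt (fun x => g (displacement c t - x) * φ (t, x)) (fx t x) x := by
    intro t x
    have h1 : HasDerivAt (fun x => g (displacement c t - x))
        (deriv g (displacement c t - x) * (-1)) x :=
      (dg _).comp x ((hasDerivAt_id x).const_sub _)
    have h2 : HasDerivAt (fun x => φ (t, x)) (fderiv ℝ φ (t, x) (0, 1)) x :=
      (dφ (t, x)).comp_hasDerivAt x ((hasDerivAt_const x t).prodMk (hasDerivAt_id x))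
    refine (h1.mul h2).congr_deriv ?_
    simp only [fx]; ring
  have cft : Continuous (Function.uncurry ft) := by
    simp only [ft, Function.uncurry_def]; fun_prop
  have cfx : Continuous (Function.uncurry fx) := by
    simp only [fx, Function.uncurry_def]; fun_prop
  have ift : ∀ t, IntervalIntegrable (fun x => ft t x) volume 0 1 := fun t =>
    (cft.comp (by fun_prop : Continuous fun x : ℝ => (t, x))).intervalIntegrable _ _
  have ifx : ∀ t, IntervalIntegrable (fun x => fx t x) volume 0 1 := fun t =>
    (cfx.comp (by fun_prop : Continuous fun x : ℝ => (t, x))).intervalIntegrable _ _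
  have e1 : ∀ t, ∫ x in (0 : ℝ)..1, g (displacement c t - x) * materialDeriv c φ t x =
      (∫ x in (0 : ℝ)..1, ft t x) +
        c t * (g (displacement c t - 1) * φ (t, 1) - g (displacement c t) * φ (t, 0)) := by
    intro t
    have : ∫ x in (0 : ℝ)..1, fx t x =
        g (displacement c t - 1) * φ (t, 1) - g (displacement c t - 0) * φ (t, 0) :=
      intervalIntegral.integral_eq_sub_of_hasDerivAt (fun x _ => dx t x) (ifx t)
    rw [sub_zero] at this
    rw [← this, ← intervalIntegral.integral_const_mul, ← intervalIntegral.integral_add (ift t)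
      ((ifx t).const_mul _)]
    refine intervalIntegral.integral_congr fun x _ => ?_
    -- The terms containing the derivative of `g` cancel here.
    simp only [ft, fx, materialDeriv]; ring
  have cit : Continuous fun t => ∫ x in (0 : ℝ)..1, ft t x :=
    intervalIntegral.continuous_parametric_intervalIntegral_of_continuous' cft _ _
  have e2 : ∫ t in (0 : ℝ)..T, ∫ x in (0 : ℝ)..1, ft t x =
      -∫ x in (0 : ℝ)..1, g (-x) * φ (0, x) := by
    rw [intervalIntegral_intervalIntegral_swap]
    · rw [← intervalIntegral.integral_neg]
      refine intervalIntegral.integral_congr fun x hx => ?_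
      rw [uIcc_of_le zero_le_one] at hx
      have := intervalIntegral.integral_eq_sub_of_hasDerivAt (a := 0) (b := T)
        (fun t _ => dt t x)
        ((cft.comp (by fun_prop : Continuous fun t : ℝ => (t, x))).intervalIntegrable _ _)
      simpa [hφT x hx] using this
    · exact (cft.continuousOn.integrableOn_compact (isCompact_uIcc.prod isCompact_uIcc)).mono_set
        (prod_mono uIoc_subset_uIcc uIoc_subset_uIcc)
  rw [weakDefect, intervalIntegral.integral_congr (fun t _ => e1 t), intervalIntegral.integral_add
    (cit.intervalIntegrable _ _) (Continuous.intervalIntegrable (by fun_prop) _ _), e2]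
  simp only [mul_sub, ← mul_assoc]
  rw [intervalIntegral.integral_sub (Continuous.intervalIntegrable (by fun_prop) _ _)
    (Continuous.intervalIntegrable (by fun_prop) _ _)]
  ring

lemma exists_bound_materialDeriv (hc : IsVelocity m M c) (hφ : ContDiff ℝ 1 φ) (hT : 0 ≤ T) :
    ∃ R : ℝ, 0 ≤ R ∧ (∀ t ∈ Icc 0 T, ∀ x ∈ Icc (0 : ℝ) 1, |materialDeriv c φ t x| ≤ R) ∧
      ∀ t ∈ Icc 0 T, ∀ x ∈ Icc (0 : ℝ) 1, |φ (t, x)| ≤ R := by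
  have K : IsCompact (Icc 0 T ×ˢ Icc (0 : ℝ) 1) := isCompact_Icc.prod isCompact_Icc
  obtain ⟨R₁, h₁⟩ := K.exists_bound_of_continuousOn
    (continuous_materialDeriv hc.continuous hφ).continuousOn
  obtain ⟨R₂, h₂⟩ := K.exists_bound_of_continuousOn hφ.continuous.continuousOn
  refine ⟨max R₁ R₂, ?_, fun t ht x hx => (h₁ (t, x) ⟨ht, hx⟩).trans (le_max_left _ _),
    fun t ht x hx => (h₂ (t, x) ⟨ht, hx⟩).trans (le_max_right _ _)⟩
  exact (norm_nonneg _).trans ((h₁ (0, 0) ⟨⟨le_rfl, hT⟩, ⟨le_rfl, zero_le_one⟩⟩).trans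
    (le_max_left _ _))

end

section

variable {m M T : ℝ} {c : ℝ → ℝ} {φ : ℝ × ℝ → ℝ} {g : ℝ → ℝ}

lemma measurable_inner_weakDefect (hc : IsVelocity m M c) (hφ : ContDiff ℝ 1 φ)
    (hg : Measurable g) :
    Measurable fun t => ∫ x in (0 : ℝ)..1, g (displacement c t - x) * materialDeriv c φ t x := by
  have h1 := (continuous_materialDeriv hc.continuous hφ).measurable
  have h2 := hc.continuous_displacement.measurable
  simp only [intervalIntegral.integral_of_le zero_le_one]
  refine StronglyMeasurable.measurable ?_
  refine StronglyMeasurable.integral_prod_right' (f := fun q : ℝ × ℝ =>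
    g (displacement c q.1 - q.2) * materialDeriv c φ q.1 q.2) ?_
  exact Measurable.stronglyMeasurable (by fun_prop)

lemma intervalIntegrable_inner_weakDefect (hc : IsVelocity m M c) (hφ : ContDiff ℝ 1 φ)
    (hT : 0 ≤ T) (hg : Measurable g) {B : ℝ} (hB : ∀ z, |g z| ≤ B) {t : ℝ} (ht : t ∈ Icc 0 T) :
    IntervalIntegrable (fun x => g (displacement c t - x) * materialDeriv c φ t x) volume 0 1 := by
  obtain ⟨R, hR, h1, -⟩ := exists_bound_materialDeriv hc hφ hT
  have hm : Measurable fun x => materialDeriv c φ t x :=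
    ((continuous_materialDeriv hc.continuous hφ).comp
      (by fun_prop : Continuous fun x : ℝ => (t, x))).measurable
  refine intervalIntegrable_of_measurable_of_bdd (B := B * R) (by fun_prop) fun x hx => ?_
  rw [uIcc_of_le zero_le_one] at hx
  rw [abs_mul]
  exact mul_le_mul (hB _) (h1 t ht x hx) (abs_nonneg _) ((abs_nonneg _).trans (hB 0))

/-- By translation invariance the bound involves only the L¹ norm of `g`, as the density argument
requires. -/
lemma abs_inner_weakDefect_le {R : ℝ} (hR : 0 ≤ R)
    (h1 : ∀ t ∈ Icc 0 T, ∀ x ∈ Icc (0 : ℝ) 1, |materialDeriv c φ t x| ≤ R)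
    (hi : Integrable g) {t : ℝ} (ht : t ∈ Icc 0 T) :
    |∫ x in (0 : ℝ)..1, g (displacement c t - x) * materialDeriv c φ t x| ≤ R * ∫ z, |g z| := by
  have hi' : Integrable fun x => |g (displacement c t - x)| := (hi.comp_sub_left _).abs
  rw [← Real.norm_eq_abs]
  refine (intervalIntegral.norm_integral_le_of_norm_le (g := fun x =>
    R * |g (displacement c t - x)|) zero_le_one (.of_forall fun x hx => ?_)
    (hi'.const_mul R).intervalIntegrable).trans ?_
  · rw [Real.norm_eq_abs, abs_mul, mul_comm]
    exact mul_le_mul_of_nonneg_right (h1 t ht x ⟨hx.1.le, hx.2⟩) (abs_nonneg _)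
  · rw [intervalIntegral.integral_const_mul]
    refine mul_le_mul_of_nonneg_left ?_ hR
    rw [intervalIntegral.integral_of_le zero_le_one, ← integral_sub_left_eq_self (fun z => |g z|)
      volume (displacement c t)]
    exact setIntegral_le_integral hi' (.of_forall fun _ => abs_nonneg _)

/-- The flux through a point is controlled by the total mass. -/
lemma integral_flux_le (hc : IsVelocity m M c) (hi : Integrable g) (hT : 0 ≤ T) (x : ℝ) :
    ∫ t in (0 : ℝ)..T, c t * |g (displacement c t - x)| ≤ ∫ z, |g z| := by
  have hi' : Integrable fun z => |g (z - x)| := (hi.comp_sub_right x).abs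
  rw [← hc.integral_displacement 0 T fun z => |g (z - x)|,
    ← integral_sub_right_eq_self (fun z => |g z|) x,
    intervalIntegral.integral_of_le (hc.strictMono_displacement.monotone hT)]
  exact setIntegral_le_integral hi' (.of_forall fun _ => abs_nonneg _)

lemma intervalIntegrable_flux (hc : IsVelocity m M c) (hφ : ContDiff ℝ 1 φ)
    (hT : 0 ≤ T) (hg : Measurable g) {B : ℝ} (hB : ∀ z, |g z| ≤ B) {x : ℝ}
    (hx : x ∈ Icc (0 : ℝ) 1) :
    IntervalIntegrable (fun t => c t * g (displacement c t - x) * φ (t, x)) volume 0 T := by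
  obtain ⟨R, hR, -, h1⟩ := exists_bound_materialDeriv hc hφ hT
  have h2 := hc.continuous_displacement.measurable
  have h3 := hc.continuous.measurable
  have h4 := hφ.continuous.measurable
  refine intervalIntegrable_of_measurable_of_bdd (B := M * B * R) (by fun_prop) fun t ht => ?_
  rw [uIcc_of_le hT] at ht
  have hB0 := (abs_nonneg _).trans (hB 0)
  have hM0 := (abs_nonneg _).trans (hc.abs_le 0)
  rw [abs_mul, abs_mul]
  exact mul_le_mul (mul_le_mul (hc.abs_le t) (hB _) (abs_nonneg _) hM0) (h1 t ht x hx)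
    (abs_nonneg _) (by positivity)

lemma abs_flux_le (hc : IsVelocity m M c) (hT : 0 ≤ T) {R : ℝ} (hR : 0 ≤ R)
    (hg : Measurable g) {B : ℝ} (hB : ∀ z, |g z| ≤ B) (hi : Integrable g) {x : ℝ}
    (h1 : ∀ t ∈ Icc 0 T, |φ (t, x)| ≤ R) :
    |∫ t in (0 : ℝ)..T, c t * g (displacement c t - x) * φ (t, x)| ≤ R * ∫ z, |g z| := by
  have h2 := hc.continuous_displacement.measurable
  have h3 := hc.continuous.measurable
  rw [← Real.norm_eq_abs]
  refine (intervalIntegral.norm_integral_le_of_norm_le (g := fun t =>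
    R * (c t * |g (displacement c t - x)|)) hT (.of_forall fun t ht => ?_)
    (IntervalIntegrable.const_mul ?_ R)).trans ?_
  · rw [Real.norm_eq_abs, abs_mul, abs_mul, mul_comm, abs_of_pos (hc.velocity_pos t)]
    exact mul_le_mul_of_nonneg_right (h1 t ⟨ht.1.le, ht.2⟩)
      (mul_nonneg (hc.velocity_pos t).le (abs_nonneg _))
  · refine intervalIntegrable_of_measurable_of_bdd (B := M * B) (h3.mul
      (hg.comp (h2.sub_const x)).abs) fun t _ => ?_
    rw [abs_mul, abs_abs]
    exact mul_le_mul (hc.abs_le t) (hB _) (abs_nonneg _) ((abs_nonneg _).trans (hc.abs_le 0))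
  · rw [intervalIntegral.integral_const_mul]
    exact mul_le_mul_of_nonneg_left (integral_flux_le hc hi hT x) hR

lemma intervalIntegrable_initial (hφ : ContDiff ℝ 1 φ) (hg : Measurable g) {B : ℝ}
    (hB : ∀ z, |g z| ≤ B) :
    IntervalIntegrable (fun x => g (-x) * φ (0, x)) volume 0 1 := by
  have h4 := hφ.continuous
  refine IntervalIntegrable.mul_continuousOn (intervalIntegrable_of_measurable_of_bdd (B := B)
    (by fun_prop) fun _ _ => hB _) (by fun_prop)

lemma weakDefect_sub (hc : IsVelocity m M c) (hφ : ContDiff ℝ 1 φ) (hT : 0 ≤ T) {g₁ g₂ : ℝ → ℝ}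
    (hg₁ : Measurable g₁) (hg₂ : Measurable g₂) {B₁ B₂ : ℝ} (hB₁ : ∀ z, |g₁ z| ≤ B₁)
    (hB₂ : ∀ z, |g₂ z| ≤ B₂) (hi₁ : Integrable g₁) (hi₂ : Integrable g₂) :
    weakDefect T c φ (g₁ - g₂) = weakDefect T c φ g₁ - weakDefect T c φ g₂ := by
  obtain ⟨R, hR, h1, -⟩ := exists_bound_materialDeriv hc hφ hT
  have e0 : IntervalIntegrable (fun t => c t * g₁ (displacement c t) * φ (t, 0)) volume 0 T := by
    simpa using intervalIntegrable_flux hc hφ hT hg₁ hB₁ (x := 0) (by simp)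
  have e0' : IntervalIntegrable (fun t => c t * g₂ (displacement c t) * φ (t, 0)) volume 0 T := by
    simpa using intervalIntegrable_flux hc hφ hT hg₂ hB₂ (x := 0) (by simp)
  have i1 := intervalIntegrable_flux hc hφ hT hg₁ hB₁ (x := 1) (by simp)
  have i1' := intervalIntegrable_flux hc hφ hT hg₂ hB₂ (x := 1) (by simp)
  have out : ∀ {g : ℝ → ℝ}, Measurable g → Integrable g → IntervalIntegrable (fun t =>
      ∫ x in (0 : ℝ)..1, g (displacement c t - x) * materialDeriv c φ t x) volume 0 T :=
    fun {g} hg hi => intervalIntegrable_of_measurable_of_bdd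
      (measurable_inner_weakDefect hc hφ hg) fun t ht =>
      abs_inner_weakDefect_le hR h1 hi (by rwa [uIcc_of_le hT] at ht)
  have inner : ∫ t in (0 : ℝ)..T, ∫ x in (0 : ℝ)..1,
      (g₁ - g₂) (displacement c t - x) * materialDeriv c φ t x =
      (∫ t in (0 : ℝ)..T, ∫ x in (0 : ℝ)..1, g₁ (displacement c t - x) * materialDeriv c φ t x) -
      ∫ t in (0 : ℝ)..T, ∫ x in (0 : ℝ)..1, g₂ (displacement c t - x) * materialDeriv c φ t x := by
    rw [← intervalIntegral.integral_sub (out hg₁ hi₁) (out hg₂ hi₂)]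
    refine intervalIntegral.integral_congr fun t ht => ?_
    rw [uIcc_of_le hT] at ht
    simp only [Pi.sub_apply, sub_mul]
    exact intervalIntegral.integral_sub (intervalIntegrable_inner_weakDefect hc hφ hT hg₁ hB₁ ht)
      (intervalIntegrable_inner_weakDefect hc hφ hT hg₂ hB₂ ht)
  rw [weakDefect, inner]
  simp only [Pi.sub_apply, sub_mul, mul_sub]
  rw [intervalIntegral.integral_sub e0 e0', intervalIntegral.integral_sub i1 i1',
    intervalIntegral.integral_sub (intervalIntegrable_initial hφ hg₁ hB₁)
      (intervalIntegrable_initial hφ hg₂ hB₂), weakDefect, weakDefect]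
  ring

/-- For fixed `φ` the defect is continuous in `g` for the L¹ norm. In the constant `R * (T + 3)`,
the interior term contributes `T` and the initial, inflow and outflow terms one each. -/
lemma exists_weakDefect_le (hc : IsVelocity m M c) (hφ : ContDiff ℝ 1 φ) (hT : 0 ≤ T) :
    ∃ R : ℝ, 0 ≤ R ∧ ∀ g : ℝ → ℝ, Measurable g → (∃ B, ∀ z, |g z| ≤ B) → Integrable g →
      |weakDefect T c φ g| ≤ R * ∫ z, |g z| := by
  obtain ⟨R, hR, h1, h2⟩ := exists_bound_materialDeriv hc hφ hT
  refine ⟨R * (T + 3), by positivity, fun g hg ⟨B, hB⟩ hi => ?_⟩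
  have a1 : |∫ t in (0 : ℝ)..T, ∫ x in (0 : ℝ)..1,
      g (displacement c t - x) * materialDeriv c φ t x| ≤ R * (∫ z, |g z|) * T := by
    have := intervalIntegral.norm_integral_le_of_norm_le_const (a := 0) (b := T)
      (f := fun t => ∫ x in (0 : ℝ)..1, g (displacement c t - x) * materialDeriv c φ t x)
      (C := R * ∫ z, |g z|) fun t ht => by
        rw [uIoc_of_le hT] at ht
        exact abs_inner_weakDefect_le hR h1 hi ⟨ht.1.le, ht.2⟩
    simpa [abs_of_nonneg hT] using this
  have a2 : |∫ x in (0 : ℝ)..1, g (-x) * φ (0, x)| ≤ R * ∫ z, |g z| := by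
    have hi' : Integrable fun x => |g (-x)| := hi.comp_neg.abs
    rw [← Real.norm_eq_abs]
    refine (intervalIntegral.norm_integral_le_of_norm_le (g := fun x => R * |g (-x)|) zero_le_one
      (.of_forall fun x hx => ?_) (hi'.const_mul R).intervalIntegrable).trans ?_
    · rw [Real.norm_eq_abs, abs_mul, mul_comm]
      exact mul_le_mul_of_nonneg_right (h2 0 ⟨le_rfl, hT⟩ x ⟨hx.1.le, hx.2⟩) (abs_nonneg _)
    · rw [intervalIntegral.integral_const_mul]
      refine mul_le_mul_of_nonneg_left ?_ hR
      rw [intervalIntegral.integral_of_le zero_le_one, ← integral_neg_eq_self (fun z => |g z|)]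
      exact setIntegral_le_integral hi' (.of_forall fun _ => abs_nonneg _)
  have a3 : |∫ t in (0 : ℝ)..T, c t * g (displacement c t) * φ (t, 0)| ≤ R * ∫ z, |g z| := by
    simpa using abs_flux_le hc hT hR hg hB hi (x := 0) fun t ht => h2 t ht 0 (by simp)
  have a4 := abs_flux_le hc hT hR hg hB hi (x := 1) fun t ht => h2 t ht 1 (by simp)
  rw [weakDefect]
  rw [abs_le] at *
  constructor <;> nlinarith

/-- The density `g (C(t) - x)` satisfies the weak formulation of the transport equation. -/
theorem weakDefect_eq_zero (hc : IsVelocity m M c) (hφ : ContDiff ℝ 1 φ) (hT : 0 ≤ T)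
    (hφT : ∀ x ∈ Icc (0 : ℝ) 1, φ (T, x) = 0) (hg : Measurable g) {B : ℝ} (hB : ∀ z, |g z| ≤ B)
    (hi : Integrable g) : weakDefect T c φ g = 0 := by
  obtain ⟨R, hR, hR'⟩ := exists_weakDefect_le hc hφ hT
  refine abs_eq_zero.1 (le_antisymm (le_of_forall_pos_le_add fun ε hε => ?_) (abs_nonneg _))
  -- A smooth, compactly supported `h` close to `g` in L¹ has no defect, so that of `g` is that of
  -- `g - h`. Dividing by `R + 1` covers `R = 0`.
  obtain ⟨h, hhc, hhd, hle⟩ := MemLp.exist_eLpNorm_sub_le (p := 1) (by simp) le_rfl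
    (memLp_one_iff_integrable.2 hi) (ε := ε / (R + 1)) (by positivity)
  have hhi : Integrable h := hhd.continuous.integrable_of_hasCompactSupport hhc
  obtain ⟨B', hB'⟩ := hhc.exists_bound_of_continuous hhd.continuous
  have key : weakDefect T c φ g = weakDefect T c φ (g - h) := by
    rw [weakDefect_sub hc hφ hT hg hhd.continuous.measurable hB hB' hi hhi,
      weakDefect_eq_zero_of_contDiff hc hφ hφT (hhd.of_le (by simp)), sub_zero]
  rw [key]
  have hint : ∫ z, |(g - h) z| ≤ ε / (R + 1) := by
    rw [eLpNorm_one_eq_lintegral_enorm] at hle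
    simp only [← Real.norm_eq_abs]
    rw [integral_norm_eq_lintegral_enorm (hi.sub hhi).aestronglyMeasurable]
    exact ENNReal.toReal_le_of_le_ofReal (by positivity) hle
  refine (hR' _ (hg.sub hhd.continuous.measurable) ⟨B + B', fun z => ?_⟩ (hi.sub hhi)).trans ?_
  · exact (abs_sub _ _).trans (add_le_add (hB z) (hB' z))
  · refine (mul_le_mul_of_nonneg_left hint hR).trans ?_
    rw [zero_add, mul_div_assoc', div_le_iff₀ (by positivity)]
    nlinarith

end

/-! ### Moving densities as curves in L^p. -/

lemma integral_zero_one_eq (f : ℝ → ℝ) :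
    ∫ x in (0 : ℝ)..1, f x = ∫ x in Ioo (0 : ℝ) 1, f x := by
  rw [intervalIntegral.integral_of_le zero_le_one, integral_Ioc_eq_integral_Ioo]

instance : IsProbabilityMeasure (volume.restrict (Ioo (0 : ℝ) 1)) := ⟨by simp⟩

lemma memLp_comp_sub_of_bdd {g : ℝ → ℝ} (hg : Measurable g) {B : ℝ} (hB : ∀ z, |g z| ≤ B)
    (p : ℝ≥0∞) (s : ℝ) : MemLp (fun x => g (s - x)) p (volume.restrict (Ioo (0 : ℝ) 1)) :=
  MemLp.of_bound (Measurable.aestronglyMeasurable (by fun_prop)) B (.of_forall fun _ => hB _)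

open Classical in
/-- The density `x ↦ g (s - x)` on the unit interval. -/
noncomputable def advect (p : ℝ≥0∞) (g : ℝ → ℝ) (s : ℝ) : LpUnit p :=
  if h : MemLp (fun x => g (s - x)) p (volume.restrict (Ioo (0 : ℝ) 1)) then h.toLp _ else 0

lemma coeFn_advect {g : ℝ → ℝ} (hg : Measurable g) {B : ℝ} (hB : ∀ z, |g z| ≤ B)
    (p : ℝ≥0∞) (s : ℝ) :
    advect p g s =ᵐ[volume.restrict (Ioo (0 : ℝ) 1)] fun x => g (s - x) := by
  have h := memLp_comp_sub_of_bdd hg hB p s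
  rw [advect, dif_pos h]
  exact h.coeFn_toLp

lemma memLp_of_bdd_of_support {g : ℝ → ℝ} (hg : Measurable g) {B R : ℝ} (hB : ∀ z, |g z| ≤ B)
    (hR : ∀ z, R < |z| → g z = 0) (p : ℝ≥0∞) : MemLp g p volume := by
  have : g = (Icc (-R) R).indicator g := by
    refine (indicator_eq_self.2 fun z hz => ?_).symm
    by_contra h
    rw [mem_Icc, ← abs_le, not_le] at h
    exact hz (hR z h)
  rw [this, memLp_indicator_iff_restrict measurableSet_Icc]
  exact MemLp.of_bound hg.aestronglyMeasurable B (.of_forall hB)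

/-- Translation acts continuously on L^p of the line for finite `p`, and restriction to the unit
interval is continuous. -/
lemma continuous_advect {p : ℝ≥0∞} [Fact (1 ≤ p)] (hp : p ≠ ∞) {g : ℝ → ℝ} (hg : Measurable g)
    {B R : ℝ} (hB : ∀ z, |g z| ≤ B) (hR : ∀ z, R < |z| → g z = 0) : Continuous (advect p g) := by
  have : Fact (p ≠ ∞) := ⟨hp⟩
  have hf : MemLp (fun x => g (-x)) p volume := memLp_of_bdd_of_support (hg.comp measurable_neg)
    (fun z => hB _) (R := R) (fun z hz => hR _ (by rwa [abs_neg])) p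
  -- After reflecting `g`, the function x ↦ g(s - x) is a translate: shifting the argument by `-s`
  -- turns x ↦ g(-x) into it.
  have : advect p g = fun s : ℝ => LpToLpRestrictCLM ℝ ℝ ℝ volume p (Ioo 0 1)
      (DomAddAct.mk (-s) +ᵥ hf.toLp _) := by
    funext s
    refine Lp.ext ?_
    refine (coeFn_advect hg hB p s).trans ?_
    refine Filter.EventuallyEq.trans ?_ (LpToLpRestrictCLM_coeFn ℝ (Ioo 0 1) _).symm
    rw [DomAddAct.mk_vadd_toLp]
    refine (ae_restrict_of_ae ((MemLp.coeFn_toLp (hf.comp_measurePreserving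
      (measurePreserving_vadd (-s) volume))).mono fun x hx => ?_))
    refine Eq.trans ?_ hx.symm
    simp [sub_eq_add_neg, add_comm]
  rw [this]
  refine (ContinuousLinearMap.continuous _).comp ?_
  have hmk : Continuous fun s : ℝ => DomAddAct.mk (-s) :=
    DomAddAct.continuous_mk.comp continuous_neg
  exact hmk.vadd continuous_const

lemma isWeakTransportSolution_advect {m M T : ℝ} {c : ℝ → ℝ} (hc : IsVelocity m M c) (hT : 0 ≤ T)
    (p : ℝ≥0∞) {g : ℝ → ℝ} (hg : Measurable g) {B R : ℝ} (hB : ∀ z, |g z| ≤ B)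
    (hR : ∀ z, R < |z| → g z = 0) :
    IsWeakTransportSolution T c (fun x => g (-x)) (fun t => c t * g (displacement c t))
      (fun t => c t * g (displacement c t - 1)) (fun t => advect p g (displacement c t)) := by
  intro φ hφ hφT
  refine Eq.trans ?_ (weakDefect_eq_zero hc hφ hT hφT hg hB
    (memLp_one_iff_integrable.1 (memLp_of_bdd_of_support hg hB hR 1)))
  rw [weakDefect]
  congr 1; congr 1; congr 1
  refine intervalIntegral.integral_congr fun t _ => ?_
  simp only [integral_zero_one_eq]
  refine integral_congr_ae ?_
  filter_upwards [coeFn_advect hg hB p (displacement c t)] with x hx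
  rw [hx, materialDeriv]

lemma IsWeakTransportSolution.congr {p : ℝ≥0∞} {T : ℝ} (hT : 0 ≤ T) {c c' r₀ r₀' u u' y y' : ℝ → ℝ}
    {r r' : ℝ → LpUnit p} (h : IsWeakTransportSolution T c r₀ u y r)
    (hc : ∀ t ∈ Icc 0 T, c t = c' t)
    (hr₀ : r₀ =ᵐ[volume.restrict (Ioo 0 1)] r₀') (hu : u =ᵐ[volume.restrict (Ioo 0 T)] u')
    (hy : y =ᵐ[volume.restrict (Ioo 0 T)] y') (hr : ∀ t ∈ Icc 0 T, r t = r' t) :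
    IsWeakTransportSolution T c' r₀' u' y' r' := by
  intro φ hφ hφT
  refine Eq.trans ?_ (h φ hφ hφT)
  simp only [integral_zero_one_eq]
  have e : ∀ {f f' : ℝ → ℝ}, f =ᵐ[volume.restrict (Ioo 0 T)] f' →
      ∫ t in (0 : ℝ)..T, f t = ∫ t in (0 : ℝ)..T, f' t := fun {f f'} hf => by
    rw [intervalIntegral.integral_of_le hT, intervalIntegral.integral_of_le hT,
      integral_Ioc_eq_integral_Ioo, integral_Ioc_eq_integral_Ioo]
    exact integral_congr_ae hf
  congr 1
  · congr 1
    · congr 1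
      · refine intervalIntegral.integral_congr fun t ht => ?_
        rw [uIcc_of_le hT] at ht
        simp only [hc t ht, hr t ht]
      · exact integral_congr_ae (hr₀.mono fun x hx => by simp only [hx])
    · exact e (hu.mono fun x hx => by simp only [hx])
  · exact e (hy.mono fun x hx => by simp only [hx])

/-! ### Pairing L^p curves with continuous functions. -/

section pairing

variable {p : ℝ≥0∞} [Fact (1 ≤ p)]

lemma integrable_lpUnit (F : LpUnit p) : Integrable F (volume.restrict (Ioo (0 : ℝ) 1)) :=
  memLp_one_iff_integrable.1 ((Lp.memLp F).mono_exponent Fact.out)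

lemma integral_abs_le_norm (F : LpUnit p) : ∫ x in Ioo (0 : ℝ) 1, |F x| ≤ ‖F‖ := by
  simp only [← Real.norm_eq_abs]
  rw [integral_norm_eq_lintegral_enorm (integrable_lpUnit F).aestronglyMeasurable,
    ← eLpNorm_one_eq_lintegral_enorm, Lp.norm_def]
  exact ENNReal.toReal_mono (Lp.eLpNorm_ne_top F)
    (eLpNorm_le_eLpNorm_of_exponent_le Fact.out (Lp.aestronglyMeasurable F))

lemma integrable_lpUnit_mul (F : LpUnit p) {w : ℝ → ℝ} (hw : ContinuousOn w (Icc 0 1)) :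
    Integrable (fun x => F x * w x) (volume.restrict (Ioo (0 : ℝ) 1)) := by
  obtain ⟨S, hS⟩ := isCompact_Icc.exists_bound_of_continuousOn hw
  refine (integrable_lpUnit F).mul_bdd (c := S) ?_ ?_
  · exact (hw.mono Ioo_subset_Icc_self).aestronglyMeasurable measurableSet_Ioo
  · exact (ae_restrict_iff' measurableSet_Ioo).2 (.of_forall fun x hx => hS x ⟨hx.1.le, hx.2.le⟩)

lemma abs_integral_lpUnit_mul_le (F : LpUnit p) {w : ℝ → ℝ} {S : ℝ}
    (hS : ∀ x ∈ Icc (0 : ℝ) 1, |w x| ≤ S) :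
    |∫ x in Ioo (0 : ℝ) 1, F x * w x| ≤ S * ‖F‖ := by
  have hS0 : 0 ≤ S := (abs_nonneg _).trans (hS 0 (by simp))
  rw [← Real.norm_eq_abs]
  refine (norm_integral_le_of_norm_le ((integrable_lpUnit F).abs.const_mul S) ?_).trans ?_
  · refine (ae_restrict_iff' measurableSet_Ioo).2 (.of_forall fun x hx => ?_)
    rw [Real.norm_eq_abs, abs_mul, mul_comm]
    exact mul_le_mul_of_nonneg_right (hS x ⟨hx.1.le, hx.2.le⟩) (abs_nonneg _)
  · rw [integral_const_mul]
    exact mul_le_mul_of_nonneg_left (integral_abs_le_norm F) hS0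

/-- The pairing of a continuous curve in `L^p` with a continuous function is continuous. -/
lemma continuousOn_integral_lpUnit_mul {T : ℝ} {r : ℝ → LpUnit p} (hr : ContinuousOn r (Icc 0 T))
    {k : ℝ → ℝ → ℝ} (hk : Continuous (Function.uncurry k)) :
    ContinuousOn (fun t => ∫ x in Ioo (0 : ℝ) 1, r t x * k t x) (Icc 0 T) := by
  obtain ⟨S, hS⟩ := (isCompact_Icc (a := (0 : ℝ)) (b := T)).prod
    (isCompact_Icc (a := (0 : ℝ)) (b := 1)) |>.exists_bound_of_continuousOn hk.continuousOn
  have hkt : ∀ t, ContinuousOn (k t) (Icc 0 1) := fun t =>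
    (hk.comp (by fun_prop : Continuous fun x : ℝ => (t, x))).continuousOn
  intro s hs
  -- The first part is small because `r` is continuous and `k` is bounded; in the second only `k`
  -- varies, and dominated convergence applies.
  have split : ∀ t, ∫ x in Ioo (0 : ℝ) 1, r t x * k t x =
      (∫ x in Ioo (0 : ℝ) 1, (r t - r s : LpUnit p) x * k t x) +
        ∫ x in Ioo (0 : ℝ) 1, r s x * k t x := fun t => by
    rw [← integral_add (integrable_lpUnit_mul _ (hkt t)) (integrable_lpUnit_mul _ (hkt t))]
    refine integral_congr_ae ?_
    filter_upwards [Lp.coeFn_sub (r t) (r s)] with x hx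
    rw [hx, Pi.sub_apply]; ring
  refine Filter.Tendsto.congr (fun t => (split t).symm) ?_
  beta_reduce
  rw [← zero_add (∫ x in Ioo (0 : ℝ) 1, r s x * k s x)]
  refine Filter.Tendsto.add ?_ ?_
  · have h0 : Filter.Tendsto (fun t => S * ‖r t - r s‖) (nhdsWithin s (Icc 0 T)) (nhds 0) := by
      have : Filter.Tendsto (fun t => S * ‖r t - r s‖) (nhdsWithin s (Icc 0 T))
          (nhds (S * ‖r s - r s‖)) := (((hr s hs).sub_const (r s)).norm.const_mul S)
      simpa using this
    refine squeeze_zero_norm' ?_ h0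
    filter_upwards [self_mem_nhdsWithin] with t ht
    exact abs_integral_lpUnit_mul_le _ fun x hx => hS (t, x) ⟨ht, hx⟩
  · refine continuousWithinAt_of_dominated (bound := fun x => |r s x| * S) ?_ ?_ ?_ ?_
    · exact .of_forall fun t => (integrable_lpUnit_mul _ (hkt t)).aestronglyMeasurable
    · filter_upwards [self_mem_nhdsWithin] with t ht
      refine (ae_restrict_iff' measurableSet_Ioo).2 (.of_forall fun x hx => ?_)
      rw [norm_mul, Real.norm_eq_abs]
      exact mul_le_mul_of_nonneg_left (hS (t, x) ⟨ht, hx.1.le, hx.2.le⟩) (abs_nonneg _)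
    · exact (integrable_lpUnit _).abs.mul_const S
    · refine .of_forall fun x => ContinuousAt.continuousWithinAt ?_
      exact (continuous_const.mul
        (hk.comp (by fun_prop : Continuous fun t : ℝ => (t, x)))).continuousAt

lemma intervalIntegrable_lpUnit (F : LpUnit p) {b d : ℝ} (hb : b ∈ Icc (0 : ℝ) 1)
    (hd : d ∈ Icc (0 : ℝ) 1) : IntervalIntegrable F volume b d := by
  have h : IntervalIntegrable F volume 0 1 := by
    rw [intervalIntegrable_iff_integrableOn_Ioo_of_le zero_le_one]
    exact integrable_lpUnit F
  exact h.mono_set (by rw [uIcc_of_le (zero_le_one' ℝ)]; exact uIcc_subset_Icc hb hd)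

lemma ae_uIoc_of_ae_unit {b d : ℝ} (hb : b ∈ Icc (0 : ℝ) 1) (hd : d ∈ Icc (0 : ℝ) 1) {P : ℝ → Prop}
    (h : ∀ᵐ x ∂volume.restrict (Ioo (0 : ℝ) 1), P x) : ∀ᵐ x, x ∈ uIoc b d → P x := by
  rw [restrict_Ioo_eq_restrict_Ioc, ae_restrict_iff' measurableSet_Ioc] at h
  filter_upwards [h] with x hx hxm
  rcases le_total b d with hbd | hbd
  · rw [uIoc_of_le hbd] at hxm
    exact hx ⟨hb.1.trans_lt hxm.1, hxm.2.trans hd.2⟩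
  · rw [uIoc_of_ge hbd] at hxm
    exact hx ⟨hd.1.trans_lt hxm.1, hxm.2.trans hb.2⟩

/-- The mass between two positions depends continuously on the density. -/
lemma continuous_integral_lpUnit {b d : ℝ} (hb : b ∈ Icc (0 : ℝ) 1) (hd : d ∈ Icc (0 : ℝ) 1) :
    Continuous fun F : LpUnit p => ∫ x in b..d, F x := by
  refine LipschitzWith.continuous (K := 1) (LipschitzWith.of_dist_le_mul fun F G => ?_)
  rw [Real.dist_eq, dist_eq_norm, NNReal.coe_one, one_mul, ← intervalIntegral.integral_sub
    (intervalIntegrable_lpUnit F hb hd) (intervalIntegrable_lpUnit G hb hd)]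
  have : ∫ x in b..d, (F x - G x) = ∫ x in b..d, (F - G : LpUnit p) x := by
    refine intervalIntegral.integral_congr_ae (ae_uIoc_of_ae_unit hb hd ?_)
    filter_upwards [Lp.coeFn_sub F G] with x hx
    rw [hx, Pi.sub_apply]
  rw [this, ← Real.norm_eq_abs]
  refine intervalIntegral.norm_integral_le_integral_norm_uIoc.trans
    (le_trans ?_ (integral_abs_le_norm (F - G)))
  rw [← integral_Ioc_eq_integral_Ioo]
  refine setIntegral_mono_set ?_ (.of_forall fun _ => norm_nonneg _) (.of_forall fun x hx => ?_)
  · rw [IntegrableOn, ← restrict_Ioo_eq_restrict_Ioc]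
    exact (integrable_lpUnit _).norm
  · rcases le_total b d with hbd | hbd
    · rw [uIoc_of_le hbd] at hx
      exact ⟨hb.1.trans_lt hx.1, hx.2.trans hd.2⟩
    · rw [uIoc_of_ge hbd] at hx
      exact ⟨hd.1.trans_lt hx.1, hx.2.trans hb.2⟩

end pairing

/-! ### Uniqueness for a given velocity. -/

section

open scoped ContDiff

variable {p : ℝ≥0∞} [Fact (1 ≤ p)]

lemma continuousOn_eq_zero_of_ae_Ioo {q : ℝ → ℝ} {a b : ℝ} (hab : a < b)
    (hq : ContinuousOn q (Icc a b)) (h : ∀ᵐ t, t ∈ Ioo a b → q t = 0) :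
    ∀ t ∈ Icc a b, q t = 0 := by
  have h1 : q =ᵐ[volume.restrict (Icc a b)] fun _ => 0 := by
    rw [← restrict_Ioo_eq_restrict_Icc]
    exact (ae_restrict_iff' measurableSet_Ioo).2 h
  exact fun t ht => Measure.eqOn_Icc_of_ae_eq volume hab.ne h1 hq continuousOn_const ht

/-- Testing with functions that are constant along the characteristics determines the densities. -/
lemma IsWeakTransportSolution.integral_comp_sub_eq {m M T : ℝ} {c r₀ u y y' : ℝ → ℝ}
    {r r' : ℝ → LpUnit p} (hc : IsVelocity m M c) (hr : ContinuousOn r (Icc 0 T))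
    (hr' : ContinuousOn r' (Icc 0 T)) (h : IsWeakTransportSolution T c r₀ u y r)
    (h' : IsWeakTransportSolution T c r₀ u y' r') {t₀ : ℝ} (ht₀ : t₀ ∈ Ioc 0 T) {k : ℝ → ℝ}
    (hk : ContDiff ℝ 1 k) (hk0 : ∀ w, 1 - displacement c t₀ ≤ w → k w = 0) :
    ∫ x in Ioo (0 : ℝ) 1, r t₀ x * k (x - displacement c t₀) =
      ∫ x in Ioo (0 : ℝ) 1, r' t₀ x * k (x - displacement c t₀) := by
  have hT : 0 ≤ T := ht₀.1.le.trans ht₀.2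
  have hC := hc.continuous_displacement
  have hkk : Continuous (Function.uncurry fun t x : ℝ => k (x - displacement c t)) := by
    have := hk.continuous
    simp only [Function.uncurry_def]; fun_prop
  have cont : ContinuousOn (fun t =>
      (∫ x in Ioo (0 : ℝ) 1, r t x * k (x - displacement c t)) -
        ∫ x in Ioo (0 : ℝ) 1, r' t x * k (x - displacement c t)) (Icc 0 T) :=
    (continuousOn_integral_lpUnit_mul hr hkk).sub (continuousOn_integral_lpUnit_mul hr' hkk)
  -- The difference of the pairings is continuous in time, so vanishing almost everywhere on (0,t₀)
  -- gives the endpoint `t₀`.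
  refine sub_eq_zero.1 (continuousOn_eq_zero_of_ae_Ioo ht₀.1
    (cont.mono (Icc_subset_Icc_right ht₀.2)) ?_ t₀ ⟨ht₀.1.le, le_rfl⟩)
  refine isOpen_Ioo.ae_eq_zero_of_integral_contDiff_smul_eq_zero
    (((cont.mono (Icc_subset_Icc_right ht₀.2)).mono Ioo_subset_Icc_self).locallyIntegrableOn
      measurableSet_Ioo) fun ζ hζ hζc hζs => ?_
  have hζ0 : ∀ t, t₀ ≤ t → ζ t = 0 := fun t ht =>
    image_eq_zero_of_notMem_tsupport fun hm => absurd (hζs hm).2 (not_lt.2 ht)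
  have hζ0' : ∀ t, t ≤ 0 → ζ t = 0 := fun t ht =>
    image_eq_zero_of_notMem_tsupport fun hm => absurd (hζs hm).1 (not_lt.2 ht)
  -- This primitive vanishes from `t₀` on. Hence the product of `η` with k(x - C(t)) is admissible
  -- at `T`, and its derivative along characteristics is `ζ` times the second factor.
  let η : ℝ → ℝ := fun t => ∫ s in t₀..t, ζ s
  have hη : ∀ t, HasDerivAt η (ζ t) t := fun t =>
    intervalIntegral.integral_hasDerivAt_right (hζ.continuous.intervalIntegrable _ _)
      (hζ.continuous.stronglyMeasurableAtFilter _ _) hζ.continuous.continuousAt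
  have hηd : ContDiff ℝ 1 η := by
    rw [contDiff_one_iff_deriv, funext fun t => (hη t).deriv]
    exact ⟨fun t => (hη t).differentiableAt, hζ.continuous⟩
  have hη0 : ∀ t, t₀ ≤ t → η t = 0 := fun t ht => by
    simp only [η]
    rw [intervalIntegral.integral_congr (g := fun _ => 0)]
    · simp
    · intro s hs
      rw [uIcc_of_le ht] at hs
      exact hζ0 s hs.1
  let φ : ℝ × ℝ → ℝ := fun q => η q.1 * k (q.2 - displacement c q.1)
  have hφ : ContDiff ℝ 1 φ := by
    have := hc.contDiff_displacement
    simp only [φ]; fun_prop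
  have hφT : ∀ x ∈ Icc (0 : ℝ) 1, φ (T, x) = 0 := fun x _ => by
    simp [φ, hη0 T ht₀.2]
  -- Before `t₀` the argument 1 - C(t) is at least 1 - C(t₀), where `k` vanishes. The unknown
  -- outflows are therefore not seen by the test function.
  have hφ1 : ∀ t, φ (t, 1) = 0 := fun t => by
    rcases le_total t₀ t with ht | ht
    · simp [φ, hη0 t ht]
    · simp only [φ]
      rw [hk0, mul_zero]
      have := hc.strictMono_displacement.monotone ht
      linarith
  have hφd : ∀ t x, fderiv ℝ φ (t, x) (1, 0) + c t * fderiv ℝ φ (t, x) (0, 1) =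
      ζ t * k (x - displacement c t) := by
    intro t x
    have d1 : HasFDerivAt φ (fderiv ℝ φ (t, x)) (t, x) :=
      (hφ.differentiable one_ne_zero _).hasFDerivAt
    -- Differentiate `φ` along the characteristic through `(t, x)`, on which the factor `k` is
    -- constant.
    have d2 : HasDerivAt (fun s => φ (s, x + (displacement c s - displacement c t)))
        (fderiv ℝ φ (t, x) (1, c t)) t := by
      have d1' : HasFDerivAt φ (fderiv ℝ φ (t, x))
          (t, x + (displacement c t - displacement c t)) := by
        simpa using d1
      exact d1'.comp_hasDerivAt t ((hasDerivAt_id t).prodMk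
        (((hc.hasDerivAt_displacement t).sub_const _).const_add x))
    have d3 : HasDerivAt (fun s => φ (s, x + (displacement c s - displacement c t)))
        (ζ t * k (x - displacement c t)) t := by
      have : (fun s => φ (s, x + (displacement c s - displacement c t))) =
          fun s => η s * k (x - displacement c t) := by
        funext s; simp only [φ]; congr 2; ring
      rw [this]
      exact (hη t).mul_const _
    rw [← d2.unique d3, ← smul_eq_mul, ← map_smul, ← map_add]
    simp
  have eq := h φ hφ hφT
  have eq' := h' φ hφ hφT
  simp only [hφd, hφ1, mul_zero, intervalIntegral.integral_zero, sub_zero] at eq eq'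
  have key : ∀ {r : ℝ → LpUnit p}, (∫ t in (0 : ℝ)..T, ∫ x in (0 : ℝ)..1,
      r t x * (ζ t * k (x - displacement c t))) =
      ∫ t in (0 : ℝ)..T, ζ t * ∫ x in Ioo (0 : ℝ) 1, r t x * k (x - displacement c t) := by
    intro r
    refine intervalIntegral.integral_congr fun t _ => ?_
    simp only [integral_zero_one_eq, ← integral_const_mul]
    refine integral_congr_ae (.of_forall fun x => ?_)
    simp only; ring
  rw [key] at eq eq'
  have ii : ∀ {r : ℝ → LpUnit p}, ContinuousOn r (Icc 0 T) → IntervalIntegrable (fun t =>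
      ζ t * ∫ x in Ioo (0 : ℝ) 1, r t x * k (x - displacement c t)) volume 0 T := fun hr =>
    ContinuousOn.intervalIntegrable (by
      rw [uIcc_of_le hT]
      exact hζ.continuous.continuousOn.mul (continuousOn_integral_lpUnit_mul hr hkk))
  simp only [smul_eq_mul, mul_sub]
  rw [← setIntegral_eq_integral_of_forall_compl_eq_zero (s := Ioc 0 T), ←
    intervalIntegral.integral_of_le hT, intervalIntegral.integral_sub (ii hr) (ii hr')]
  · linarith
  · intro t ht
    have : ζ t = 0 := by
      rcases le_or_gt t 0 with h0 | h0
      · exact hζ0' t h0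
      · exact hζ0 t (ht₀.2.trans (not_le.1 fun hle => ht ⟨h0, hle⟩).le)
    simp [this]

lemma lpUnit_ext_of_integral {F G : LpUnit p} (h : ∀ ξ : ℝ → ℝ, ContDiff ℝ ∞ ξ →
    HasCompactSupport ξ → tsupport ξ ⊆ Ioo 0 1 →
    ∫ x in Ioo (0 : ℝ) 1, F x * ξ x = ∫ x in Ioo (0 : ℝ) 1, G x * ξ x) : F = G := by
  refine Lp.ext ((ae_restrict_iff' measurableSet_Ioo).2 ?_)
  have : ∀ᵐ x, x ∈ Ioo (0 : ℝ) 1 → F x - G x = 0 := by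
    refine isOpen_Ioo.ae_eq_zero_of_integral_contDiff_smul_eq_zero ?_ fun ξ hξ hξc hξs => ?_
    · exact IntegrableOn.locallyIntegrableOn ((integrable_lpUnit F).sub (integrable_lpUnit G))
    · rw [← setIntegral_eq_integral_of_forall_compl_eq_zero (s := Ioo 0 1)]
      · simp only [smul_eq_mul, mul_sub]
        have i := fun F : LpUnit p => integrable_lpUnit_mul F hξ.continuous.continuousOn
        simp only [mul_comm (ξ _)]
        rw [integral_sub (i F) (i G), h ξ hξ hξc hξs, sub_self]
      · intro x hx
        rw [image_eq_zero_of_notMem_tsupport fun hm => hx (hξs hm), zero_smul]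
  filter_upwards [this] with x hx hxm using sub_eq_zero.1 (hx hxm)

/-- Uniqueness for the transport equation with a given velocity. -/
theorem IsWeakTransportSolution.unique {m M T : ℝ} {c r₀ u y y' : ℝ → ℝ}
    {r r' : ℝ → LpUnit p} (hT : 0 < T) (hc : IsVelocity m M c) (hr : ContinuousOn r (Icc 0 T))
    (hr' : ContinuousOn r' (Icc 0 T)) (hy : IntegrableOn y (Ioo 0 T))
    (hy' : IntegrableOn y' (Ioo 0 T)) (h : IsWeakTransportSolution T c r₀ u y r)
    (h' : IsWeakTransportSolution T c r₀ u y' r') :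
    (∀ t ∈ Icc 0 T, r t = r' t) ∧ y =ᵐ[volume.restrict (Ioo 0 T)] y' := by
  have pos : ∀ t ∈ Ioc 0 T, r t = r' t := by
    intro t ht
    refine lpUnit_ext_of_integral fun ξ hξ _ hξs => ?_
    have := h.integral_comp_sub_eq hc hr hr' h' ht
      (k := fun w => ξ (w + displacement c t)) ((hξ.of_le (by simp)).comp (by fun_prop)) ?_
    · simpa using this
    · intro w hw
      refine image_eq_zero_of_notMem_tsupport fun hm => absurd (hξs hm).2 (not_lt.2 ?_)
      linarith
  -- Time 0 is reached by continuity.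
  have hrr : ∀ t ∈ Icc 0 T, r t = r' t := by
    have cl : closure (Ioc 0 T) = Icc 0 T := closure_Ioc hT.ne
    exact Set.EqOn.of_subset_closure (s := Ioc 0 T) pos hr hr' Ioc_subset_Icc_self cl.ge
  refine ⟨hrr, (ae_restrict_iff' measurableSet_Ioo).2 ?_⟩
  -- Once the densities agree, test functions of `t` alone isolate the outflows.
  have : ∀ᵐ t, t ∈ Ioo 0 T → y t - y' t = 0 := by
    refine isOpen_Ioo.ae_eq_zero_of_integral_contDiff_smul_eq_zero ?_ fun ζ hζ hζc hζs => ?_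
    · exact IntegrableOn.locallyIntegrableOn (hy.sub hy')
    · have hz : ∀ t, t ∉ Ioo 0 T → ζ t = 0 := fun t ht =>
        image_eq_zero_of_notMem_tsupport fun hm => ht (hζs hm)
      have hφ : ContDiff ℝ 1 fun q : ℝ × ℝ => ζ q.1 := by
        have := hζ.of_le (m := 1) (by simp)
        fun_prop
      have eq := h (fun q => ζ q.1) hφ fun x _ => hz T (by simp)
      have eq' := h' (fun q => ζ q.1) hφ fun x _ => hz T (by simp)
      have same : ∀ f : ℝ → ℝ → ℝ, (∫ t in (0 : ℝ)..T, ∫ x in (0 : ℝ)..1, r t x * f t x) =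
          ∫ t in (0 : ℝ)..T, ∫ x in (0 : ℝ)..1, r' t x * f t x := fun f => by
        refine intervalIntegral.integral_congr fun t ht => ?_
        rw [uIcc_of_le hT.le] at ht
        simp only [hrr t ht]
      rw [same fun t x => _] at eq
      have i : ∀ {y : ℝ → ℝ}, IntegrableOn y (Ioo 0 T) →
          Integrable (fun t => y t * ζ t) (volume.restrict (Ioo 0 T)) := fun hy => by
        obtain ⟨S, hS⟩ := hζc.exists_bound_of_continuous hζ.continuous
        exact Integrable.mul_bdd (c := S) hy hζ.continuous.aestronglyMeasurable (.of_forall hS)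
      rw [← setIntegral_eq_integral_of_forall_compl_eq_zero (s := Ioo 0 T)]
      · simp only [smul_eq_mul, mul_comm (ζ _), sub_mul]
        rw [integral_sub (i hy) (i hy'), ← integral_Ioc_eq_integral_Ioo,
          ← integral_Ioc_eq_integral_Ioo, ← intervalIntegral.integral_of_le hT.le,
          ← intervalIntegral.integral_of_le hT.le]
        linarith
      · intro t ht
        rw [hz t ht, zero_smul]
  filter_upwards [this] with t ht htm using sub_eq_zero.1 (ht htm)

end

/-! ### Regular representatives of the data and truncation of the velocity law. -/

/-- Profiles evaluate the data at passage times, so bounds that hold everywhere, and not just almost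
everywhere, are convenient. They are obtained by clamping a measurable representative and cutting it
off outside `I`. -/
lemma IsNonnegLinfty.exists_measurable_bounded {I : Set ℝ} (hI : MeasurableSet I) {f : ℝ → ℝ}
    (hf : IsNonnegLinfty I f) :
    ∃ (f' : ℝ → ℝ) (B : ℝ), Measurable f' ∧ (∀ x, 0 ≤ f' x) ∧ (∀ x, f' x ≤ B) ∧
      (∀ x, x ∉ I → f' x = 0) ∧ f =ᵐ[volume.restrict I] f' := by
  obtain ⟨⟨hm, hfin⟩, h0⟩ := hf
  set B := (eLpNormEssSup f (volume.restrict I)).toReal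
  have hB : ∀ᵐ x ∂volume.restrict I, ‖f x‖ ≤ B := by
    rw [eLpNorm_exponent_top] at hfin
    filter_upwards [ae_le_eLpNormEssSup (f := f) (μ := volume.restrict I)] with x hx
    rw [← toReal_enorm]
    exact ENNReal.toReal_mono hfin.ne hx
  have hB0 : 0 ≤ B := ENNReal.toReal_nonneg
  refine ⟨I.indicator fun x => max 0 (min (hm.mk f x) B), B, ?_, ?_, ?_, ?_, ?_⟩
  · exact (measurable_const.max (hm.stronglyMeasurable_mk.measurable.min measurable_const)).indicator
      hI
  · exact indicator_nonneg fun x _ => le_max_left _ _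
  · exact fun x => indicator_apply_le' (fun _ => max_le hB0 (min_le_right _ _)) fun _ => hB0
  · exact fun x hx => indicator_of_notMem hx _
  · filter_upwards [hm.ae_eq_mk, hB, h0, ae_restrict_mem hI] with x h1 h2 h3 h4
    rw [indicator_of_mem h4, ← h1, min_eq_left ((le_abs_self _).trans h2), max_eq_right h3]

lemma isNonnegLinfty_of_bounded {I : Set ℝ} {f : ℝ → ℝ} (hm : Measurable f)
    (h0 : ∀ x, 0 ≤ f x) {B : ℝ} (hB : ∀ x, f x ≤ B) : IsNonnegLinfty I f :=
  ⟨memLp_top_of_bound hm.aestronglyMeasurable B (.of_forall fun x => by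
    rw [Real.norm_eq_abs, abs_of_nonneg (h0 x)]; exact hB x), .of_forall h0⟩

/-- The clamping of a real number to an interval. -/
noncomputable def clamp (a b x : ℝ) : ℝ := max a (min x b)

lemma clamp_mem {a b : ℝ} (h : a ≤ b) (x : ℝ) : clamp a b x ∈ Icc a b :=
  ⟨le_max_left _ _, max_le h (min_le_right _ _)⟩

lemma clamp_of_mem {a b x : ℝ} (h : x ∈ Icc a b) : clamp a b x = x := by
  rw [clamp, min_eq_left h.2, max_eq_right h.1]

lemma continuous_clamp (a b : ℝ) : Continuous (clamp a b) := by unfold clamp; fun_prop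

lemma abs_clamp_sub_clamp_le (a b x y : ℝ) : |clamp a b x - clamp a b y| ≤ |x - y| := by
  simpa [Real.dist_eq, clamp] using ((LipschitzWith.id.min_const b).const_max a).dist_le_mul x y

/-- A positive `C¹` velocity law, modified for large loads so that it is globally Lipschitz in the
load and has positive bounds. -/
lemma exists_truncation {T : ℝ} (hT : 0 < T) {lam : ℝ → ℝ → ℝ}
    (hlam : ContDiffOn ℝ 1 (Function.uncurry lam) (Icc 0 T ×ˢ univ))
    (hpos : ∀ t ∈ Icc 0 T, ∀ w, 0 < lam t w) {M₀ : ℝ} (hM₀ : 0 ≤ M₀) :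
    ∃ (lam' : ℝ → ℝ → ℝ) (m M L : ℝ), 0 < m ∧ 0 ≤ L ∧ Continuous (Function.uncurry lam') ∧
      (∀ t w, m ≤ lam' t w) ∧ (∀ t w, lam' t w ≤ M) ∧
      (∀ t w w', |lam' t w - lam' t w'| ≤ L * |w - w'|) ∧
      ∀ t ∈ Icc 0 T, ∀ w, |w| ≤ M₀ → lam' t w = lam t w := by
  have hM : -M₀ ≤ M₀ := by linarith
  set S := Icc 0 T ×ˢ (univ : Set ℝ)
  set K := Icc 0 T ×ˢ Icc (-M₀) M₀
  have hK : IsCompact K := isCompact_Icc.prod isCompact_Icc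
  have hKS : K ⊆ S := prod_mono subset_rfl (subset_univ _)
  have hKne : K.Nonempty := ⟨(0, 0), ⟨le_rfl, hT.le⟩, by simpa using hM₀, hM₀⟩
  have hS : UniqueDiffOn ℝ S := (uniqueDiffOn_Icc hT).prod uniqueDiffOn_univ
  obtain ⟨q₁, hq₁, h₁⟩ := hK.exists_isMinOn hKne (hlam.continuousOn.mono hKS)
  obtain ⟨q₂, hq₂, h₂⟩ := hK.exists_isMaxOn hKne (hlam.continuousOn.mono hKS)
  obtain ⟨L, hL⟩ := hK.exists_bound_of_continuousOn
    ((hlam.continuousOn_fderivWithin hS le_rfl).mono hKS)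
  have hL0 : 0 ≤ L := (norm_nonneg _).trans (hL _ hKne.some_mem)
  -- The mean value inequality on the convex rectangle `K`, where the derivative is bounded by
  -- compactness.
  have lip : LipschitzOnWith ⟨L, hL0⟩ (Function.uncurry lam) K := by
    refine Convex.lipschitzOnWith_of_nnnorm_hasFDerivWithin_le (𝕜 := ℝ) (fun q hq =>
      ((hlam.differentiableOn one_ne_zero q (hKS hq)).hasFDerivWithinAt).mono hKS)
      (fun q hq => ?_) ((convex_Icc _ _).prod (convex_Icc _ _))
    exact hL q hq
  have mem : ∀ t w, (clamp 0 T t, clamp (-M₀) M₀ w) ∈ K := fun t w =>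
    ⟨clamp_mem hT.le t, clamp_mem hM w⟩
  refine ⟨fun t w => lam (clamp 0 T t) (clamp (-M₀) M₀ w), Function.uncurry lam q₁,
    Function.uncurry lam q₂, L, hpos _ hq₁.1 _, hL0, ?_, fun t w => h₁ (mem t w),
    fun t w => h₂ (mem t w), fun t w w' => ?_, fun t ht w hw => ?_⟩
  · have := continuous_clamp 0 T
    have := continuous_clamp (-M₀) M₀
    exact (hlam.continuousOn.mono hKS).comp_continuous
      (f := fun q : ℝ × ℝ => (clamp 0 T q.1, clamp (-M₀) M₀ q.2)) (by fun_prop) fun q => mem _ _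
  · have := lip.dist_le_mul _ (mem t w) _ (mem t w')
    simp only [Function.uncurry_apply_pair, Real.dist_eq, Prod.dist_eq, sub_self, abs_zero] at this
    rw [max_eq_right (abs_nonneg _)] at this
    exact this.trans (mul_le_mul_of_nonneg_left (abs_clamp_sub_clamp_le _ _ _ _) hL0)
  · simp only
    rw [clamp_of_mem ht, clamp_of_mem (abs_le.1 hw)]

/-! ### The explicit solution for a given velocity. -/

/-- The inflow through `x = 0`, where the initial density is regarded as having entered at velocity
`c₀` before time `0`. -/
noncomputable def extendedInflow (c₀ : ℝ) (r₀ u : ℝ → ℝ) (t : ℝ) : ℝ :=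
  if t < 0 then c₀ * r₀ (-(c₀ * t)) else u t

/-- Bounded non-negative measurable initial densities and inflows. -/
structure IsLinkDatum (T B : ℝ) (r₀ u : ℝ → ℝ) : Prop where
  measurable_initial : Measurable r₀
  measurable_inflow : Measurable u
  initial_nonneg : ∀ x, 0 ≤ r₀ x
  inflow_nonneg : ∀ t, 0 ≤ u t
  initial_le : ∀ x, r₀ x ≤ B
  inflow_le : ∀ t, u t ≤ B
  initial_eq_zero : ∀ x, x ∉ Ioo (0 : ℝ) 1 → r₀ x = 0
  inflow_eq_zero : ∀ t, t ∉ Ioo 0 T → u t = 0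

namespace IsLinkDatum

variable {T B c₀ : ℝ} {r₀ u : ℝ → ℝ}

lemma bound_nonneg (h : IsLinkDatum T B r₀ u) : 0 ≤ B := (h.initial_nonneg 0).trans (h.initial_le 0)

lemma measurable_extendedInflow (h : IsLinkDatum T B r₀ u) (c₀ : ℝ) :
    Measurable (extendedInflow c₀ r₀ u) := by
  have h1 := h.measurable_initial
  have h2 := h.measurable_inflow
  exact Measurable.ite measurableSet_Iio (by fun_prop) h2

lemma extendedInflow_nonneg (h : IsLinkDatum T B r₀ u) (hc₀ : 0 < c₀) (t : ℝ) :
    0 ≤ extendedInflow c₀ r₀ u t := by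
  unfold extendedInflow
  split_ifs
  · exact mul_nonneg hc₀.le (h.initial_nonneg _)
  · exact h.inflow_nonneg t

lemma extendedInflow_le (h : IsLinkDatum T B r₀ u) (hc₀ : 0 < c₀) (t : ℝ) :
    extendedInflow c₀ r₀ u t ≤ (c₀ + 1) * B := by
  have := h.bound_nonneg
  unfold extendedInflow
  split_ifs
  · have := mul_le_mul_of_nonneg_left (h.initial_le (-(c₀ * t))) hc₀.le
    linarith
  · have := h.inflow_le t
    have := mul_nonneg hc₀.le h.bound_nonneg
    linarith

lemma abs_extendedInflow_le (h : IsLinkDatum T B r₀ u) (hc₀ : 0 < c₀) (t : ℝ) :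
    |extendedInflow c₀ r₀ u t| ≤ (c₀ + 1) * B := by
  rw [abs_of_nonneg (h.extendedInflow_nonneg hc₀ t)]
  exact h.extendedInflow_le hc₀ t

/-- At velocity `c₀` the link is crossed in time `c₀⁻¹`, so no initial mass entered earlier than
that. -/
lemma extendedInflow_eq_zero (h : IsLinkDatum T B r₀ u) (hc₀ : 0 < c₀) {t : ℝ}
    (ht : max c₀⁻¹ T < |t|) : extendedInflow c₀ r₀ u t = 0 := by
  obtain ⟨h1, h2⟩ := max_lt_iff.1 ht
  unfold extendedInflow
  split_ifs with h0
  · rw [abs_of_neg h0, inv_lt_iff_one_lt_mul₀ hc₀] at h1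
    rw [h.initial_eq_zero, mul_zero]
    rintro ⟨-, h3⟩
    linarith
  · rw [abs_of_nonneg (not_lt.1 h0)] at h2
    exact h.inflow_eq_zero t fun hm => absurd hm.2 (not_lt.2 h2.le)

end IsLinkDatum

lemma IsVelocity.abs_displacement_le {m M : ℝ} {c : ℝ → ℝ} (h : IsVelocity m M c) (t : ℝ) :
    |displacement c t| ≤ M * |t| := by
  simpa [displacement] using
    intervalIntegral.norm_integral_le_of_norm_le_const (a := 0) (b := t) (f := c) (C := M)
    fun s _ => h.abs_le s

section

variable {m M T B c₀ : ℝ} {c r₀ u : ℝ → ℝ} {p : ℝ≥0∞}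

/-- The factor `c₀` in the extended inflow cancels the division by the velocity, so the profile
reproduces the initial density. -/
lemma profile_extendedInflow_neg (hc : IsVelocity m M c) (h0 : ∀ t ≤ 0, c t = c₀) {x : ℝ}
    (hx : 0 < x) : profile c (extendedInflow c₀ r₀ u) (-x) = r₀ x := by
  have hc₀ : 0 < c₀ := h0 0 le_rfl ▸ hc.velocity_pos 0
  have hneg : -x / c₀ < 0 := div_neg_of_neg_of_pos (by linarith) hc₀
  rw [profile, hc.passage_of_nonpos h0 (by linarith), h0 _ hneg.le, extendedInflow, if_pos hneg]
  have : -(c₀ * (-x / c₀)) = x := by field_simp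
  rw [this]; field_simp

lemma profile_eq_zero (hc : IsVelocity m M c) {w : ℝ → ℝ} {R : ℝ} (hw : ∀ t, R < |t| → w t = 0)
    {z : ℝ} (hz : M * R < |z|) : profile c w z = 0 := by
  rw [profile, hw, zero_div]
  have := hc.abs_displacement_le (passage c z)
  rw [hc.displacement_passage] at this
  exact lt_of_mul_lt_mul_left (hz.trans_le this) ((abs_nonneg _).trans (hc.abs_le 0))

lemma IsLinkDatum.continuous_advect [Fact (1 ≤ p)] (hp : p ≠ ∞) (h : IsLinkDatum T B r₀ u)
    (hc : IsVelocity m M c) (hc₀ : 0 < c₀) :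
    Continuous fun t => advect p (profile c (extendedInflow c₀ r₀ u)) (displacement c t) :=
  (_root_.continuous_advect hp (hc.measurable_profile (h.measurable_extendedInflow c₀))
    (hc.abs_profile_le (h.abs_extendedInflow_le hc₀))
    fun _ hz => profile_eq_zero hc (fun _ => h.extendedInflow_eq_zero hc₀) hz).comp
    hc.continuous_displacement

/-- The transport equation with a given velocity has an explicit solution. -/
lemma IsLinkDatum.isWeakTransportSolution (hT : 0 ≤ T) (h : IsLinkDatum T B r₀ u)
    (hc : IsVelocity m M c) (h0 : ∀ t ≤ 0, c t = c₀) (p : ℝ≥0∞) :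
    IsWeakTransportSolution T c r₀ u
      (fun t => c t * profile c (extendedInflow c₀ r₀ u) (displacement c t - 1))
      (fun t => advect p (profile c (extendedInflow c₀ r₀ u)) (displacement c t)) := by
  have hc₀ : 0 < c₀ := h0 0 le_rfl ▸ hc.velocity_pos 0
  refine (isWeakTransportSolution_advect hc hT p
    (hc.measurable_profile (h.measurable_extendedInflow c₀))
    (hc.abs_profile_le (h.abs_extendedInflow_le hc₀))
    fun _ hz => profile_eq_zero hc (fun _ => h.extendedInflow_eq_zero hc₀) hz).congr hT
    (fun _ _ => rfl) ?_ ?_ .rfl fun _ _ => rfl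
  · refine (ae_restrict_iff' measurableSet_Ioo).2 (.of_forall fun x hx => ?_)
    exact profile_extendedInflow_neg hc h0 hx.1
  · refine (ae_restrict_iff' measurableSet_Ioo).2 (.of_forall fun t ht => ?_)
    simp only [hc.mul_profile, extendedInflow, if_neg (not_lt.2 ht.1.le)]

end

lemma IsNonnegLinfty.integrableOn {I : Set ℝ} {f : ℝ → ℝ} (h : IsNonnegLinfty I f)
    (hI : volume I ≠ ∞) : IntegrableOn f I := by
  have : IsFiniteMeasure (volume.restrict I) := ⟨by simpa using hI.lt_top⟩
  exact memLp_one_iff_integrable.1 (h.1.mono_exponent le_top)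

lemma IsLinkDatum.isNonnegLinfty_outflow {T B m M c₀ : ℝ} {r₀ u c : ℝ → ℝ}
    (h : IsLinkDatum T B r₀ u) (hc : IsVelocity m M c) (hc₀ : 0 < c₀) (I : Set ℝ) :
    IsNonnegLinfty I
      fun t => c t * profile c (extendedInflow c₀ r₀ u) (displacement c t - 1) := by
  have h3 := hc.measurable_profile (h.measurable_extendedInflow c₀)
  have h4 := hc.continuous_displacement.measurable
  have h5 := hc.continuous.measurable
  refine isNonnegLinfty_of_bounded (by fun_prop) (fun t => mul_nonneg (hc.velocity_pos t).le
    (hc.profile_nonneg (h.extendedInflow_nonneg hc₀) _)) (B := M * ((c₀ + 1) * B / m)) fun t => ?_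
  exact mul_le_mul (hc.upper t) ((le_abs_self _).trans
    (hc.abs_profile_le (h.abs_extendedInflow_le hc₀) _))
    (hc.profile_nonneg (h.extendedInflow_nonneg hc₀) _) ((abs_nonneg _).trans (hc.abs_le 0))

/-! ### Reduction of the non-local coupling to an equation for the velocity. -/

section

variable {K : Type*} [Fintype K] {p : ℝ≥0∞} {m M T b d c₀ : ℝ} {B : K → ℝ} {r₀ u : K → ℝ → ℝ}
  {c : ℝ → ℝ}

/-- The cumulative inflow of all commodities. -/
noncomputable def cumulativeInflow (c₀ : ℝ) (r₀ u : K → ℝ → ℝ) (t : ℝ) : ℝ :=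
  ∫ s in (0 : ℝ)..t, ∑ k, extendedInflow c₀ (r₀ k) (u k) s

lemma abs_sum_extendedInflow_le (h : ∀ k, IsLinkDatum T (B k) (r₀ k) (u k)) (hc₀ : 0 < c₀)
    (t : ℝ) : |∑ k, extendedInflow c₀ (r₀ k) (u k) t| ≤ ∑ k, (c₀ + 1) * B k :=
  (Finset.abs_sum_le_sum_abs _ _).trans
    (Finset.sum_le_sum fun k _ => (h k).abs_extendedInflow_le hc₀ t)

lemma measurable_sum_extendedInflow (h : ∀ k, IsLinkDatum T (B k) (r₀ k) (u k)) (c₀ : ℝ) :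
    Measurable fun t => ∑ k, extendedInflow c₀ (r₀ k) (u k) t :=
  Finset.measurable_sum _ fun k _ => (h k).measurable_extendedInflow c₀

lemma intervalIntegrable_extendedInflow (h : ∀ k, IsLinkDatum T (B k) (r₀ k) (u k))
    (hc₀ : 0 < c₀) (s t : ℝ) :
    IntervalIntegrable (fun r => ∑ k, extendedInflow c₀ (r₀ k) (u k) r) volume s t :=
  intervalIntegrable_of_measurable_of_bdd (measurable_sum_extendedInflow h c₀)
    fun _ _ => abs_sum_extendedInflow_le h hc₀ _

lemma cumulativeInflow_sub (h : ∀ k, IsLinkDatum T (B k) (r₀ k) (u k)) (hc₀ : 0 < c₀) (s t : ℝ) :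
    cumulativeInflow c₀ r₀ u t - cumulativeInflow c₀ r₀ u s =
      ∫ r in s..t, ∑ k, extendedInflow c₀ (r₀ k) (u k) r :=
  intervalIntegral.integral_interval_sub_left (intervalIntegrable_extendedInflow h hc₀ _ _)
    (intervalIntegrable_extendedInflow h hc₀ _ _)

/-- Profiles are linear in the inflow and all commodities share `c`, so only the total inflow
matters. -/
lemma integral_sum_profile (h : ∀ k, IsLinkDatum T (B k) (r₀ k) (u k)) (hc : IsVelocity m M c)
    (hc₀ : 0 < c₀) (b d t : ℝ) :
    ∫ x in b..d, ∑ k, profile c (extendedInflow c₀ (r₀ k) (u k)) (displacement c t - x) =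
      load c (cumulativeInflow c₀ r₀ u) b d t := by
  have e : ∀ z, ∑ k, profile c (extendedInflow c₀ (r₀ k) (u k)) z =
      profile c (fun t => ∑ k, extendedInflow c₀ (r₀ k) (u k) t) z := fun z => by
    simp only [profile, Finset.sum_div]
  simp only [e]
  rw [intervalIntegral.integral_comp_sub_left
    (fun z => profile c (fun t => ∑ k, extendedInflow c₀ (r₀ k) (u k) t) z), hc.integral_profile,
    load, cumulativeInflow_sub h hc₀]

lemma load_zero (h : ∀ k, IsLinkDatum T (B k) (r₀ k) (u k)) (hc : IsVelocity m M c)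
    (h0 : ∀ t ≤ 0, c t = c₀) (hb : b ∈ Icc (0 : ℝ) 1) (hd : d ∈ Icc (0 : ℝ) 1) :
    load c (cumulativeInflow c₀ r₀ u) b d 0 = ∫ x in b..d, ∑ k, r₀ k x := by
  have hc₀ : 0 < c₀ := h0 0 le_rfl ▸ hc.velocity_pos 0
  rw [← integral_sum_profile h hc hc₀]
  refine intervalIntegral.integral_congr_ae (ae_uIoc_of_ae_unit hb hd
    ((ae_restrict_iff' measurableSet_Ioo).2 (.of_forall fun x hx => ?_)))
  simp only [displacement_zero, zero_sub, profile_extendedInflow_neg hc h0 hx.1]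

lemma linkVelocity_advect (h : ∀ k, IsLinkDatum T (B k) (r₀ k) (u k)) (hc : IsVelocity m M c)
    (hc₀ : 0 < c₀) (hb : b ∈ Icc (0 : ℝ) 1) (hd : d ∈ Icc (0 : ℝ) 1) (lam : ℝ → ℝ → ℝ)
    {ρ : K → ℝ → LpUnit p} {t : ℝ} (hρ : ∀ k, ρ k t =
      advect p (profile c (extendedInflow c₀ (r₀ k) (u k))) (displacement c t)) :
    linkVelocity lam b d ρ t = lam t (load c (cumulativeInflow c₀ r₀ u) b d t) := by
  rw [linkVelocity, ← integral_sum_profile h hc hc₀]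
  congr 1
  refine intervalIntegral.integral_congr_ae (ae_uIoc_of_ae_unit hb hd ?_)
  have : ∀ᵐ x ∂volume.restrict (Ioo (0 : ℝ) 1), ∀ k, ρ k t x =
      profile c (extendedInflow c₀ (r₀ k) (u k)) (displacement c t - x) :=
    ae_all_iff.2 fun k => by
      rw [hρ k]
      exact coeFn_advect (hc.measurable_profile ((h k).measurable_extendedInflow c₀))
        (hc.abs_profile_le ((h k).abs_extendedInflow_le hc₀)) p _
  filter_upwards [this] with x hx
  simp only [hx]

lemma continuousOn_linkVelocity [Fact (1 ≤ p)] (hb : b ∈ Icc (0 : ℝ) 1) (hd : d ∈ Icc (0 : ℝ) 1)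
    {lam : ℝ → ℝ → ℝ} (hlam : ContinuousOn (Function.uncurry lam) (Icc 0 T ×ˢ univ))
    {ρ : K → ℝ → LpUnit p} (hρ : ∀ k, ContinuousOn (ρ k) (Icc 0 T)) :
    ContinuousOn (linkVelocity lam b d ρ) (Icc 0 T) := by
  have hw : ContinuousOn (fun t => ∫ x in b..d, ∑ k, ρ k t x) (Icc 0 T) := by
    have : (fun t => ∫ x in b..d, ∑ k, ρ k t x) = fun t => ∑ k, ∫ x in b..d, ρ k t x :=
      funext fun t => intervalIntegral.integral_finsetSum fun k _ =>
        intervalIntegrable_lpUnit (ρ k t) hb hd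
    rw [this]
    exact continuousOn_finsetSum _ fun k _ =>
      (continuous_integral_lpUnit hb hd).comp_continuousOn (hρ k)
  exact hlam.comp (f := fun t => (t, ∫ x in b..d, ∑ k, ρ k t x)) (continuousOn_id.prodMk hw)
    fun t ht => ⟨ht, mem_univ _⟩

/-- Every weak solution on a link is transported along its own velocity. -/
lemma exists_velocity_of_weak [Fact (1 ≤ p)] (hp : p ≠ ∞) (hT : 0 < T)
    (h : ∀ k, IsLinkDatum T (B k) (r₀ k) (u k))
    (hb : b ∈ Icc (0 : ℝ) 1) (hd : d ∈ Icc (0 : ℝ) 1) {lam : ℝ → ℝ → ℝ}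
    (hlam : ContinuousOn (Function.uncurry lam) (Icc 0 T ×ˢ univ))
    (hpos : ∀ t ∈ Icc 0 T, ∀ w, 0 < lam t w)
    {ρ : K → ℝ → LpUnit p} {y : K → ℝ → ℝ} (hρ : ∀ k, ContinuousOn (ρ k) (Icc 0 T))
    (hy : ∀ k, IntegrableOn (y k) (Ioo 0 T))
    (hw : ∀ k, IsWeakTransportSolution T (linkVelocity lam b d ρ) (r₀ k) (u k) (y k) (ρ k)) :
    ∃ (m M : ℝ) (c : ℝ → ℝ), IsVelocity m M c ∧
      (∀ t ≤ 0, c t = lam 0 (∫ x in b..d, ∑ k, r₀ k x)) ∧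
      (∀ t ∈ Icc 0 T, c t = linkVelocity lam b d ρ t) ∧
      ∀ t, c t = lam (clamp 0 T t)
        (load c (cumulativeInflow (lam 0 (∫ x in b..d, ∑ k, r₀ k x)) r₀ u)
        b d (clamp 0 T t)) := by
  have cont := continuousOn_linkVelocity hb hd hlam hρ
  obtain ⟨t₁, ht₁, h₁⟩ := isCompact_Icc.exists_isMinOn (nonempty_Icc.2 hT.le) cont
  obtain ⟨t₂, -, h₂⟩ := isCompact_Icc.exists_isMaxOn (nonempty_Icc.2 hT.le) cont
  -- The solution's own velocity, frozen outside [0,T]; its minimum over the compact interval is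
  -- attained and therefore positive.
  let c : ℝ → ℝ := fun t => linkVelocity lam b d ρ (clamp 0 T t)
  have hc : IsVelocity (linkVelocity lam b d ρ t₁) (linkVelocity lam b d ρ t₂) c :=
    ⟨hpos _ ht₁ _, cont.comp_continuous (continuous_clamp _ _) (clamp_mem hT.le),
      fun t => h₁ (clamp_mem hT.le t), fun t => h₂ (clamp_mem hT.le t)⟩
  have hcI : ∀ t ∈ Icc 0 T, c t = linkVelocity lam b d ρ t := fun t ht => by
    simp only [c, clamp_of_mem ht]
  have h0 : ∀ t ≤ 0, c t = c 0 := fun t ht => by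
    simp only [c, clamp]
    rw [max_eq_left ((min_le_left _ _).trans ht), max_eq_left (min_le_left _ _)]
  -- With `c` regarded as given, linear uniqueness identifies each density with the explicit one.
  have rep : ∀ t ∈ Icc 0 T, ∀ k, ρ k t =
      advect p (profile c (extendedInflow (c 0) (r₀ k) (u k))) (displacement c t) := by
    intro t ht k
    refine (IsWeakTransportSolution.unique hT hc (hρ k)
      ((h k).continuous_advect hp hc (hc.velocity_pos 0)).continuousOn (hy k) ?_
      ((hw k).congr hT.le (fun t ht => (hcI t ht).symm) .rfl .rfl .rfl fun _ _ => rfl)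
      ((h k).isWeakTransportSolution hT.le hc h0 p)).1 t ht
    exact ((h k).isNonnegLinfty_outflow hc (hc.velocity_pos 0) (Ioo 0 T)).integrableOn (by simp)
  have vel : ∀ t ∈ Icc 0 T, c t = lam t (load c (cumulativeInflow (c 0) r₀ u) b d t) :=
    fun t ht => by
      rw [hcI t ht]
      exact linkVelocity_advect h hc (hc.velocity_pos 0) hb hd lam (rep t ht)
  have hc0 : c 0 = lam 0 (∫ x in b..d, ∑ k, r₀ k x) := by
    rw [← load_zero h hc h0 hb hd]
    exact vel 0 ⟨le_rfl, hT.le⟩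
  refine ⟨_, _, c, hc, fun t ht => (h0 t ht).trans hc0, hcI, fun t => ?_⟩
  rw [← hc0, ← vel _ (clamp_mem hT.le t)]
  simp only [c, clamp_of_mem (clamp_mem hT.le t)]

end

section

variable {K : Type*} [Fintype K] {T c₀ : ℝ} {B : K → ℝ} {r₀ u : K → ℝ → ℝ}

lemma abs_cumulativeInflow_sub_le (h : ∀ k, IsLinkDatum T (B k) (r₀ k) (u k)) (hc₀ : 0 < c₀)
    (s t : ℝ) : |cumulativeInflow c₀ r₀ u s - cumulativeInflow c₀ r₀ u t| ≤
      (∑ k, (c₀ + 1) * B k) * |s - t| := by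
  rw [cumulativeInflow_sub h hc₀, ← Real.norm_eq_abs]
  exact intervalIntegral.norm_integral_le_of_norm_le_const fun r _ =>
    abs_sum_extendedInflow_le h hc₀ r

lemma integrable_sum_extendedInflow (h : ∀ k, IsLinkDatum T (B k) (r₀ k) (u k)) (hc₀ : 0 < c₀) :
    Integrable fun t => ∑ k, extendedInflow c₀ (r₀ k) (u k) t := by
  refine memLp_one_iff_integrable.1 (memLp_of_bdd_of_support (measurable_sum_extendedInflow h c₀)
    (abs_sum_extendedInflow_le h hc₀) (R := max c₀⁻¹ T) (fun t ht => ?_) 1)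
  exact Finset.sum_eq_zero fun k _ => (h k).extendedInflow_eq_zero hc₀ ht

/-- This a priori bound does not involve `c`, which is why truncating the velocity law beyond it
changes nothing. -/
lemma abs_load_le (h : ∀ k, IsLinkDatum T (B k) (r₀ k) (u k)) (hc₀ : 0 < c₀) (c : ℝ → ℝ)
    (b d t : ℝ) : |load c (cumulativeInflow c₀ r₀ u) b d t| ≤
      ∫ s, |∑ k, extendedInflow c₀ (r₀ k) (u k) s| := by
  rw [load, cumulativeInflow_sub h hc₀, ← Real.norm_eq_abs]
  exact intervalIntegral.norm_integral_le_integral_norm_uIoc.trans (setIntegral_le_integral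
    (integrable_sum_extendedInflow h hc₀).norm (.of_forall fun _ => norm_nonneg _))

end

/-! ### Existence and uniqueness on a single link. -/

/-- On a single link with given inflows, the non-local multi-commodity model has exactly one weak
solution. -/
theorem exists_unique_link {K : Type*} [Fintype K] {p : ℝ≥0∞} [Fact (1 ≤ p)] (hp : p ≠ ∞)
    {T : ℝ} (hT : 0 < T) {lam : ℝ → ℝ → ℝ}
    (hlam : ContDiffOn ℝ 1 (Function.uncurry lam) (Icc 0 T ×ˢ univ))
    (hpos : ∀ t ∈ Icc 0 T, ∀ w, 0 < lam t w) {b d : ℝ} (hb : b ∈ Icc (0 : ℝ) 1)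
    (hd : d ∈ Icc (0 : ℝ) 1) {r₀ u : K → ℝ → ℝ} (hr₀ : ∀ k, IsNonnegLinfty (Ioo 0 1) (r₀ k))
    (hu : ∀ k, IsNonnegLinfty (Ioo 0 T) (u k)) :
    ∃ (ρ : K → ℝ → LpUnit p) (y : K → ℝ → ℝ),
      (∀ k, ContinuousOn (ρ k) (Icc 0 T)) ∧ (∀ k, IsNonnegLinfty (Ioo 0 T) (y k)) ∧
      (∀ k, IsWeakTransportSolution T (linkVelocity lam b d ρ) (r₀ k) (u k) (y k) (ρ k)) ∧
      (∀ k, ∃ M : ℝ, ∀ t ∈ Icc 0 T,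
        ∀ᵐ x ∂volume.restrict (Ioo (0 : ℝ) 1), 0 ≤ ρ k t x ∧ ρ k t x ≤ M) ∧
      ∀ (ρ' : K → ℝ → LpUnit p) (y' : K → ℝ → ℝ),
        (∀ k, ContinuousOn (ρ' k) (Icc 0 T)) → (∀ k, IntegrableOn (y' k) (Ioo 0 T)) →
        (∀ k, IsWeakTransportSolution T (linkVelocity lam b d ρ') (r₀ k) (u k) (y' k) (ρ' k)) →
        ∀ k, (∀ t ∈ Icc 0 T, ρ' k t = ρ k t) ∧ y' k =ᵐ[volume.restrict (Ioo 0 T)] y k := by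
  choose r B₁ hr1 hr2 hr3 hr4 hr5 using fun k => (hr₀ k).exists_measurable_bounded measurableSet_Ioo
  choose v B₂ hv1 hv2 hv3 hv4 hv5 using fun k => (hu k).exists_measurable_bounded measurableSet_Ioo
  have h : ∀ k, IsLinkDatum T (max (B₁ k) (B₂ k)) (r k) (v k) := fun k =>
    ⟨hr1 k, hv1 k, hr2 k, hv2 k, fun x => (hr3 k x).trans (le_max_left _ _),
      fun t => (hv3 k t).trans (le_max_right _ _), hr4 k, hv4 k⟩
  set c₀ := lam 0 (∫ x in b..d, ∑ k, r k x)
  have h0T : (0 : ℝ) ∈ Icc 0 T := ⟨le_rfl, hT.le⟩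
  have hc₀ : 0 < c₀ := hpos 0 h0T _
  set U := cumulativeInflow c₀ r v
  obtain ⟨lam', m, M, L, hm, hL, hlc, hml, hlM, hlip, heq⟩ := exists_truncation hT hlam hpos
    (integral_nonneg fun s => abs_nonneg (∑ k, extendedInflow c₀ (r k) (v k) s))
  have heq' : ∀ c : ℝ → ℝ, ∀ t ∈ Icc 0 T, lam' t (load c U b d t) = lam t (load c U b d t) :=
    fun c t ht => heq t ht _ (abs_load_le h hc₀ c b d t)
  -- The load at time 0 is the same for every velocity equal to `c₀` before 0, so it is computed
  -- with the constant velocity.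
  have compat : lam' 0 (U (-b / c₀) - U (-d / c₀)) = c₀ := by
    have hcc : IsVelocity c₀ c₀ fun _ => c₀ :=
      ⟨hc₀, continuous_const, fun _ => le_rfl, fun _ => le_rfl⟩
    have e : load (fun _ => c₀) U b d 0 = U (-b / c₀) - U (-d / c₀) := by
      have hb' : 0 - b ≤ 0 := by linarith [hb.1]
      have hd' : 0 - d ≤ 0 := by linarith [hd.1]
      rw [load, displacement_zero, hcc.passage_of_nonpos (fun _ _ => rfl) hb',
        hcc.passage_of_nonpos (fun _ _ => rfl) hd', zero_sub, zero_sub]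
    rw [← e, heq' _ 0 h0T, load_zero h hcc (fun _ _ => rfl) hb hd]
  have hK : 0 ≤ ∑ k, (c₀ + 1) * max (B₁ k) (B₂ k) :=
    Finset.sum_nonneg fun k _ => mul_nonneg (by linarith) (h k).bound_nonneg
  obtain ⟨c, ⟨hc, hc0, hce⟩, huniq⟩ := exists_unique_velocity hlc hm hml hlM hL hlip hK
    (abs_cumulativeInflow_sub_le h hc₀) hT.le hb.1 hd.1 compat
  let g : K → ℝ → ℝ := fun k => profile c (extendedInflow c₀ (r k) (v k))
  let ρ : K → ℝ → LpUnit p := fun k t => advect p (g k) (displacement c t)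
  let y : K → ℝ → ℝ := fun k t => c t * g k (displacement c t - 1)
  have hvel : ∀ t ∈ Icc 0 T, c t = linkVelocity lam b d ρ t := fun t ht => by
    rw [linkVelocity_advect h hc hc₀ hb hd lam (fun k => rfl), ← heq' _ t ht, hce t]
    change lam' (clamp 0 T t) (load c U b d (clamp 0 T t)) = _
    rw [clamp_of_mem ht]
  have hρ : ∀ k, ContinuousOn (ρ k) (Icc 0 T) := fun k =>
    ((h k).continuous_advect hp hc hc₀).continuousOn
  have hy : ∀ k, IsNonnegLinfty (Ioo 0 T) (y k) := fun k =>
    (h k).isNonnegLinfty_outflow hc hc₀ _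
  have hweak : ∀ k, IsWeakTransportSolution T c (r k) (v k) (y k) (ρ k) := fun k =>
    (h k).isWeakTransportSolution hT.le hc hc0 p
  refine ⟨ρ, y, hρ, hy, fun k => ?_, fun k => ⟨(c₀ + 1) * max (B₁ k) (B₂ k) / m, fun t _ => ?_⟩,
    fun ρ' y' hρ' hy' hw' => ?_⟩
  · exact (hweak k).congr hT.le hvel (hr5 k).symm (hv5 k).symm .rfl fun _ _ => rfl
  · have hbd := hc.abs_profile_le ((h k).abs_extendedInflow_le hc₀)
    filter_upwards [coeFn_advect (hc.measurable_profile ((h k).measurable_extendedInflow c₀))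
      hbd p (displacement c t)] with x hx
    rw [hx]
    exact ⟨hc.profile_nonneg ((h k).extendedInflow_nonneg hc₀) _, (le_abs_self _).trans (hbd _)⟩
  · have hw : ∀ k, IsWeakTransportSolution T (linkVelocity lam b d ρ') (r k) (v k) (y' k) (ρ' k) :=
      fun k => (hw' k).congr hT.le (fun _ _ => rfl) (hr5 k) (hv5 k) .rfl fun _ _ => rfl
    obtain ⟨m', M', c', hc', hc0', hcI', hce'⟩ := exists_velocity_of_weak hp hT h hb hd
      hlam.continuousOn hpos hρ' hy' hw
    have hce'' : ∀ t, c' t = lam' (clamp 0 T t) (load c' U b d (clamp 0 T t)) := fun t => by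
      rw [heq' _ _ (clamp_mem hT.le t)]; exact hce' t
    -- The competitor comes with its own bounds `m'` and `M'`; its fixed point equation gives the
    -- bounds `m` and `M` of the truncated law instead.
    have : c' = c := huniq c' ⟨⟨hm, hc'.continuous, fun t => by rw [hce'']; exact hml _ _,
      fun t => by rw [hce'']; exact hlM _ _⟩, hc0', hce''⟩
    subst this
    intro k
    exact IsWeakTransportSolution.unique hT hc (hρ' k) (hρ k) (hy' k)
      ((hy k).integrableOn (by simp))
      ((hw k).congr hT.le (fun t ht => (hcI' t ht).symm) .rfl .rfl .rfl fun _ _ => rfl) (hweak k)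

/-! ### From links to the network. -/

lemma IsNonnegLinfty.add {I : Set ℝ} {f g : ℝ → ℝ} (hf : IsNonnegLinfty I f)
    (hg : IsNonnegLinfty I g) : IsNonnegLinfty I fun t => f t + g t :=
  ⟨hf.1.add hg.1, by filter_upwards [hf.2, hg.2] with t h1 h2 using add_nonneg h1 h2⟩

lemma IsNonnegLinfty.mul {I : Set ℝ} {f g : ℝ → ℝ} (hf : IsNonnegLinfty I f)
    (hg : IsNonnegLinfty I g) : IsNonnegLinfty I fun t => f t * g t :=
  ⟨hg.1.mul hf.1, by filter_upwards [hf.2, hg.2] with t h1 h2 using mul_nonneg h1 h2⟩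

lemma IsNonnegLinfty.sum {I : Set ℝ} {ι : Type*} (s : Finset ι) {f : ι → ℝ → ℝ}
    (hf : ∀ i ∈ s, IsNonnegLinfty I (f i)) : IsNonnegLinfty I fun t => ∑ i ∈ s, f i t := by
  refine ⟨memLp_finsetSum s fun i hi => (hf i hi).1, ?_⟩
  have : ∀ᵐ t ∂volume.restrict I, ∀ i ∈ s, 0 ≤ f i t :=
    (Finset.eventually_all s).2 fun i hi => (hf i hi).2
  filter_upwards [this] with t ht using Finset.sum_nonneg ht

namespace TrafficNetwork

variable {V : Type*} [Fintype V] [DecidableEq V]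

/-- Acyclicity makes reachability a transitive irreflexive relation on a finite set, hence
well-founded; it is pulled back along the origins of the links. -/
lemma Acyclic.wellFounded {N : TrafficNetwork V} (hN : N.Acyclic) :
    WellFounded fun a' a : N.Link => terminus a' = origin a := by
  let R : V → V → Prop := Relation.TransGen fun v w => (v, w) ∈ N.arcs
  have : Std.Irrefl R := ⟨hN⟩
  have hR : WellFounded R := Finite.wellFounded_of_trans_of_irrefl R
  refine Subrelation.wf (r := InvImage R origin) (fun {a' a} h => ?_) (InvImage.wf _ hR)
  refine Relation.TransGen.single ?_
  rw [← h]
  exact a'.2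

end TrafficNetwork

theorem mainTheorem2 {V : Type*} [Fintype V] [DecidableEq V]
    (N : TrafficNetwork V) (hN : N.Acyclic) (D : Finset V)
    (T : ℝ) (hT : 0 < T) (p : ℝ≥0∞) [Fact (1 ≤ p)] (hp : p ≠ ∞)
    (lam : N.Link → ℝ → ℝ → ℝ)
    (hlam : ∀ a, ContDiffOn ℝ 1 (Function.uncurry (lam a)) (Icc 0 T ×ˢ univ))
    (hlam_pos : ∀ a, ∀ t ∈ Icc 0 T, ∀ w, 0 < lam a t w)
    (b d : ℝ) (hb : b ∈ Icc (0 : ℝ) 1) (hd : d ∈ Icc (0 : ℝ) 1)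
    (ρ0 : N.Link → Commodity D → ℝ → ℝ) (hρ0 : ∀ a k, IsNonnegLinfty (Ioo 0 1) (ρ0 a k))
    (θ : N.Link → Commodity D → ℝ → ℝ) (hθ : N.IsSplit D T θ)
    (s : N.Link → Commodity D → ℝ → ℝ) (hs : ∀ a k, IsNonnegLinfty (Ioo 0 T) (s a k)) :
    ∃ (ρ : N.Link → Commodity D → ℝ → LpUnit p) (u y : N.Link → Commodity D → ℝ → ℝ),
      N.IsWeakSolution D T lam b d ρ0 θ s ρ u y ∧
      (∀ a k, ∃ M : ℝ, ∀ t ∈ Icc 0 T,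
        ∀ᵐ x ∂volume.restrict (Ioo (0 : ℝ) 1), 0 ≤ ρ a k t x ∧ ρ a k t x ≤ M) ∧
      (∀ a k, ∀ᵐ t ∂volume.restrict (Ioo 0 T), 0 ≤ u a k t ∧ 0 ≤ y a k t) ∧
      ∀ (ρ' : N.Link → Commodity D → ℝ → LpUnit p) (u' y' : N.Link → Commodity D → ℝ → ℝ),
        N.IsWeakSolution D T lam b d ρ0 θ s ρ' u' y' →
        ∀ a k, (∀ t ∈ Icc 0 T, ρ' a k t = ρ a k t) ∧
          ∀ᵐ t ∂volume.restrict (Ioo 0 T), u' a k t = u a k t ∧ y' a k t = y a k t := by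
  have link := fun (a : N.Link) (w : Commodity D → ℝ → ℝ)
    (hw : ∀ k, IsNonnegLinfty (Ioo 0 T) (w k)) =>
    exists_unique_link hp hT (hlam a) (hlam_pos a) hb hd (hρ0 a) hw
  choose! R Y hR hY hweak hbd huniq using link
  have hwf := hN.wellFounded
  -- The outflows are defined by recursion on the links. Summing over `attach` supplies the
  -- membership proofs which show that the incoming links are predecessors of `a`.
  let y : N.Link → Commodity D → ℝ → ℝ := hwf.fix fun a IH => Y a fun k t =>
    s a k t + θ a k t * ∑ a' ∈ (N.linksIn (TrafficNetwork.origin a)).attach,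
      IH a'.1 (Finset.mem_filter.1 a'.2).2 k t
  let u : N.Link → Commodity D → ℝ → ℝ := fun a k t =>
    s a k t + θ a k t * ∑ a' ∈ N.linksIn (TrafficNetwork.origin a), y a' k t
  have y_eq : ∀ a, y a = Y a (u a) := fun a => by
    refine (hwf.fix_eq _ a).trans (congrArg (Y a) (funext fun k => funext fun t => ?_))
    simp only [u]
    rw [← Finset.sum_attach (N.linksIn (TrafficNetwork.origin a)) fun a' => y a' k t]
  -- The single-link outflows are bounded and non-negative only if the inflows are, so this
  -- propagates along the recursion.
  have hu : ∀ a k, IsNonnegLinfty (Ioo 0 T) (u a k) := by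
    intro a
    induction a using hwf.induction with
    | _ a IH =>
      intro k
      refine (hs a k).add ((hθ.nonneg_linfty a k).mul (.sum _ fun a' ha' => ?_))
      rw [y_eq]
      exact hY a' _ (IH a' (Finset.mem_filter.1 ha').2) k
  have hy : ∀ a k, IsNonnegLinfty (Ioo 0 T) (y a k) := fun a k => by
    rw [y_eq]; exact hY a _ (hu a) k
  refine ⟨fun a => R a (u a), u, y, ⟨fun a => hR a _ (hu a),
    fun a k => (hu a k).integrableOn (by simp),
    fun a k => (hy a k).integrableOn (by simp), fun a k => ?_, fun a k => .of_forall fun t => rfl⟩,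
    fun a => hbd a _ (hu a), fun a k => ?_, fun ρ' u' y' h' => ?_⟩
  · rw [y_eq]; exact hweak a _ (hu a) k
  · filter_upwards [(hu a k).2, (hy a k).2] with t h1 h2 using ⟨h1, h2⟩
  · intro a
    induction a using hwf.induction with
    | _ a IH =>
      -- The outflows of all predecessors agree by induction, so the node condition fixes the
      -- inflow, and single-link uniqueness applies.
      have hua : ∀ k, u' a k =ᵐ[volume.restrict (Ioo 0 T)] u a k := by
        intro k
        have : ∀ᵐ t ∂volume.restrict (Ioo 0 T),
            ∀ a' ∈ N.linksIn (TrafficNetwork.origin a), y' a' k t = y a' k t :=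
          (Finset.eventually_all _).2 fun a' ha' =>
            (IH a' (Finset.mem_filter.1 ha').2 k).2.mono fun t ht => ht.2
        filter_upwards [this, h'.node a k] with t h1 h2
        rw [h2, Finset.sum_congr rfl h1]
      intro k
      obtain ⟨h1, h2⟩ := huniq a _ (hu a) (ρ' a) (y' a) (h'.continuousOn a)
        (h'.integrable_outflow a)
        (fun k => (h'.weak a k).congr hT.le (fun _ _ => rfl) .rfl (hua k) .rfl fun _ _ => rfl) k
      refine ⟨h1, ?_⟩
      filter_upwards [hua k, h2] with t h3 h4 using ⟨h3, by rw [h4, y_eq]⟩
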